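/- Let $\mathcal H$ be a finite-dimensional complex Hilbert space of dimension $N$, and $n\ge 0$ an integer. Let $\mathbf G_n\mathcal H$ be the Grassmannian of $n$-dimensional subspaces of $\mathcal H$, regarded as a submanifold of $B\mathcal H$ by identifying a subspace $V$ with the orthogonal projection onto $V$, and let $M=\{q\in B\mathcal H: q^2=q,\ \mathrm{tr}(q)=n\}$, where $\mathrm{tr}$ is the usual trace. Fix $c>0$ and put $\mathrm{Tr}=c\,\mathrm{tr}$ (for instance $c=1$, or $c=1/n$ when $n>0$, which gives the idempotents in $M$ normalized trace $1$). Then: 1. $M$ is an embedded submanifold of $B\mathcal H$ of real dimension $4n(N-n)$ (or empty), with $T_qM=\{A\in B\mathcal H: qA+Aq=A\}$; $\mathbf G_n\mathcal H$ is an embedded submanifold of $B\mathcal H$ of real dimension $2n(N-n)$ (or empty). Let $\pi(q)$ denote the orthogonal projection onto the image of $q$. The map sending $q\in M$ to the covector $A\mapsto \mathrm{Re}\,\mathrm{tr}(qA)$ at the point $\pi(q)$ is a diffeomorphism from $M$ onto the cotangent bundle $T^*\mathbf G_n\mathcal H$, and the covector vanishes exactly when $q$ is an orthogonal projection; so the zero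 section corresponds to $\mathbf G_n\mathcal H\subset M$, and the cotangent fibres correspond to the fibres of $\pi$. From now on $T^*\mathbf G_n\mathcal H$ is identified with $M$. 2. $I_q(A)=iA$ and $J_q(A)=i[A,q]$ (for $A\in T_qM$) define commuting almost complex structures $I,J$ on $T^*\mathbf G_n\mathcal H$, and both are integrable, that is, induced by complex manifold structures. 3. $\Omega_q(A,B)=i\,\mathrm{Tr}(q[A,B])$ (for $A,B\in T_qM$) defines an $I$-holomorphic symplectic form on $T^*\mathbf G_n\mathcal H$ (smooth, closed, non-degenerate, of type $(2,0)$ for $I$, with holomorphic coefficients in $I$-holomorphic coordinates), and $\Omega(JX,JY)=\Omega(X,Y)$. 4. The fibres of $T^*\mathbf G_n\mathcal H\to\mathbf G_n\mathcal H$ are Lagrangian submanifolds for $\Omega$. 5. The zero section $\mathbf G_n\mathcal H$ is Lagrangian for $\mathrm{Im}\,\Omega$, and it is Kähler for $\mathrm{Re}\,\Omega$: $J$ restricts to an integrable almost complex structure on $\mathbf G_n\mathcal H$, the restriction of $\mathrm{Re}\,\Omega$ is a $J$-invariant symplectic form, and $g(A,B)=\mathrm{Re}\,\Omega(JA,B)$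 is a Riemannian metric. -/

import Mathlib

open scoped ContDiff Topology

noncomputable section

namespace CotGr

/-! ### Embedded submanifolds of a normed space and tensors on them -/

section Submanifold

variable {E : Type*} [NormedAddCommGroup E] [NormedSpace ℝ E]
variable {F : Type*} [NormedAddCommGroup F] [NormedSpace ℝ F]
variable {W : Type*} [NormedAddCommGroup W] [NormedSpace ℝ W]

/-- `ψ : U → S` is a local parametrization (the inverse of a chart) of the embedded submanifold
`S` of `E`: a smooth immersion of an open set `U` that is a homeomorphism onto a relatively open
subset of `S`. -/
structure IsParam (S : Set E) (U : Set F) (ψ : F → E) : Prop where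
  isOpen : IsOpen U
  contDiffOn : ContDiffOn ℝ ∞ ψ U
  injective_fderiv : ∀ u ∈ U, Function.Injective (fderiv ℝ ψ u)
  mapsTo : Set.MapsTo ψ U S
  isOpenEmbedding : Topology.IsOpenEmbedding (mapsTo.restrict ψ U S)

/-- `S` is an embedded smooth submanifold of `E`, of real dimension `d`. -/
def IsSubmanifold (d : ℕ) (S : Set E) : Prop :=
  ∀ x ∈ S, ∃ (U : Set (EuclideanSpace ℝ (Fin d))) (ψ : EuclideanSpace ℝ (Fin d) → E),
    IsParam S U ψ ∧ x ∈ ψ '' U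

/-- The tangent space of `S` at `x`: (the span of) the velocities of smooth curves in `S`
through `x`. -/
def tangentSpace (S : Set E) (x : E) : Submodule ℝ E :=
  Submodule.span ℝ {v | ∃ γ : ℝ → E, ContDiffAt ℝ ∞ γ 0 ∧ (∀ᶠ t in 𝓝 0, γ t ∈ S) ∧
    γ 0 = x ∧ HasDerivAt γ v 0}

/-- The cotangent bundle of `S`, as a set: pairs of a point `x` of `S` and a real linear functional
on the tangent space at `x`. -/
def Cotangent (S : Set E) : Type _ :=
  Σ x : S, Module.Dual ℝ (tangentSpace S (x : E))

/-- `Θ` is a diffeomorphism from the submanifold `M` onto the cotangent bundle of the submanifold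
`S`. The smooth structure of the cotangent bundle is the usual one: a local parametrization `ψ` of
`S` induces the local parametrization `(u, η) ↦ (ψ u, η ∘ (Dψ_u)⁻¹)` of the cotangent bundle,
and `Θ⁻¹` has to turn each of these into a local parametrization of `M`. -/
def IsDiffeoOntoCotangent {E' : Type*} [NormedAddCommGroup E'] [NormedSpace ℝ E']
    (M : Set E') (S : Set E) (Θ : M → Cotangent S) : Prop :=
  Function.Bijective Θ ∧
  ∀ (d : ℕ) (U : Set (EuclideanSpace ℝ (Fin d))) (ψ : EuclideanSpace ℝ (Fin d) → E),
    IsParam S U ψ →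
    ∃ Ψ : EuclideanSpace ℝ (Fin d) × (EuclideanSpace ℝ (Fin d) →L[ℝ] ℝ) → E',
      IsParam M (U ×ˢ Set.univ) Ψ ∧
      ∀ u ∈ U, ∀ η : EuclideanSpace ℝ (Fin d) →L[ℝ] ℝ, ∃ hM : Ψ (u, η) ∈ M,
        ((Θ ⟨Ψ (u, η), hM⟩).1 : E) = ψ u ∧
        ∀ v, ∃ hv : fderiv ℝ ψ u v ∈ tangentSpace S ((Θ ⟨Ψ (u, η), hM⟩).1 : E),
          (Θ ⟨Ψ (u, η), hM⟩).2 ⟨fderiv ℝ ψ u v, hv⟩ = η v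

/-- `J` restricts to a smooth almost complex structure on the submanifold `S`. -/
structure IsAlmostComplex (S : Set E) (J : E → E →L[ℝ] E) : Prop where
  mem : ∀ x ∈ S, ∀ A ∈ tangentSpace S x, J x A ∈ tangentSpace S x
  sq : ∀ x ∈ S, ∀ A ∈ tangentSpace S x, J x (J x A) = -A
  smooth : ∀ (d : ℕ) (U : Set (EuclideanSpace ℝ (Fin d))) (ψ : EuclideanSpace ℝ (Fin d) → E),
    IsParam S U ψ → ∀ v, ContDiffOn ℝ ∞ (fun u => J (ψ u) (fderiv ℝ ψ u v)) U

/-- `ψ : U → S`, for `U` open in `ℂ^m`, is a local parametrization of `S` whose differential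
intertwines multiplication by `i` and `J` (the inverse of a `J`-holomorphic chart). -/
def IsHolParam (S : Set E) (J : E → E →L[ℝ] E) {m : ℕ} (U : Set (EuclideanSpace ℂ (Fin m)))
    (ψ : EuclideanSpace ℂ (Fin m) → E) : Prop :=
  IsParam S U ψ ∧
    ∀ u ∈ U, ∀ v, fderiv ℝ ψ u (Complex.I • v) = J (ψ u) (fderiv ℝ ψ u v)

/-- The almost complex structure `J` on `S` is integrable: `S` is covered by `J`-holomorphic
charts, that is, `J` comes from a structure of complex manifold on `S`. -/
def IsIntegrable (S : Set E) (J : E → E →L[ℝ] E) : Prop :=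
  ∀ x ∈ S, ∃ (m : ℕ) (U : Set (EuclideanSpace ℂ (Fin m))) (ψ : EuclideanSpace ℂ (Fin m) → E),
    IsHolParam S J U ψ ∧ x ∈ ψ '' U

/-- The pullback `ψ^* σ` of a 2-form. -/
def pullback (ψ : F → E) (σ : E → E [⋀^Fin 2]→L[ℝ] W) (u : F) : F [⋀^Fin 2]→L[ℝ] W :=
  (σ (ψ u)).compContinuousLinearMap (fderiv ℝ ψ u)

/-- `σ` restricts to a smooth symplectic form on `S`: its expression in every chart is smooth and
closed, and it is non-degenerate on every tangent space. -/
structure IsSymplectic (S : Set E) (σ : E → E [⋀^Fin 2]→L[ℝ] W) : Prop where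
  smooth : ∀ (d : ℕ) (U : Set (EuclideanSpace ℝ (Fin d))) (ψ : EuclideanSpace ℝ (Fin d) → E),
    IsParam S U ψ → ContDiffOn ℝ ∞ (pullback ψ σ) U
  closed : ∀ (d : ℕ) (U : Set (EuclideanSpace ℝ (Fin d))) (ψ : EuclideanSpace ℝ (Fin d) → E),
    IsParam S U ψ → ∀ u ∈ U, extDeriv (pullback ψ σ) u = 0
  nondegenerate : ∀ x ∈ S, ∀ A ∈ tangentSpace S x,
    (∀ B ∈ tangentSpace S x, σ x ![A, B] = 0) → A = 0

/-- The complex-valued 2-form `σ` on `S` is holomorphic for the complex structure `J`: it is of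
type `(2, 0)` and its coefficients in every `J`-holomorphic chart are holomorphic functions. -/
structure IsHolomorphicForm (S : Set E) (J : E → E →L[ℝ] E) (σ : E → E [⋀^Fin 2]→L[ℝ] ℂ) :
    Prop where
  type_two_zero : ∀ x ∈ S, ∀ A ∈ tangentSpace S x, ∀ B ∈ tangentSpace S x,
    σ x ![J x A, B] = Complex.I * σ x ![A, B]
  holomorphic : ∀ (m : ℕ) (U : Set (EuclideanSpace ℂ (Fin m))) (ψ : EuclideanSpace ℂ (Fin m) → E),
    IsHolParam S J U ψ → ∀ v w, DifferentiableOn ℂ (fun u => pullback ψ σ u ![v, w]) U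

/-- `L` is a Lagrangian submanifold of `(M, σ)`: an embedded submanifold contained in `M` whose
tangent spaces are equal to their own `σ`-orthogonal complements in the tangent spaces of `M`. -/
def IsLagrangian (M : Set E) (σ : E → E [⋀^Fin 2]→L[ℝ] W) (L : Set E) : Prop :=
  L ⊆ M ∧ (∃ d, IsSubmanifold d L) ∧
    ∀ x ∈ L, ∀ A ∈ tangentSpace M x,
      A ∈ tangentSpace L x ↔ ∀ B ∈ tangentSpace L x, σ x ![A, B] = 0

/-- `(S, J, σ)` is a Kähler manifold: `J` is an integrable almost complex structure, `σ` is a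
symplectic form, and `g(A, B) = σ(J A, B)` (equivalently `σ(A, B) = g(A, J B)`) is a `J`-invariant
Riemannian metric. -/
structure IsKahler (S : Set E) (J : E → E →L[ℝ] E) (σ : E → E [⋀^Fin 2]→L[ℝ] ℝ) : Prop where
  almostComplex : IsAlmostComplex S J
  integrable : IsIntegrable S J
  symplectic : IsSymplectic S σ
  invariant : ∀ x ∈ S, ∀ A ∈ tangentSpace S x, ∀ B ∈ tangentSpace S x,
    σ x ![J x A, J x B] = σ x ![A, B]
  pos : ∀ x ∈ S, ∀ A ∈ tangentSpace S x, A ≠ 0 → 0 < σ x ![J x A, A]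

end Submanifold

/-! ### Grassmannians, idempotents, and the structures on them -/

section Grassmannian

variable {H : Type*} [NormedAddCommGroup H] [InnerProductSpace ℂ H] [FiniteDimensional ℂ H]

variable (H) in
/-- The Grassmannian `G_n H` of `n`-dimensional subspaces `V` of `H`, embedded in `B(H)` by sending
`V` to the orthogonal projection onto `V`. -/
def grassmannian (n : ℕ) : Set (H →L[ℂ] H) :=
  {p | ∃ V : Submodule ℂ H, Module.finrank ℂ V = n ∧ V.starProjection = p}

variable (H) in
/-- The idempotents of trace `n`. -/
def idempotents (n : ℕ) : Set (H →L[ℂ] H) :=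
  {q | q * q = q ∧ LinearMap.trace ℂ H (q : H →ₗ[ℂ] H) = n}

/-- The orthogonal projection onto the image of `q`. -/
def proj (q : H →L[ℂ] H) : H →L[ℂ] H :=
  (LinearMap.range (q : H →ₗ[ℂ] H)).starProjection

/-- The trace on `B(H)`. -/
def tr : (H →L[ℂ] H) →L[ℂ] ℂ :=
  LinearMap.toContinuousLinearMap
    ((LinearMap.trace ℂ H).comp (ContinuousLinearMap.coeLM ℂ))

theorem tr_apply (A : H →L[ℂ] H) : tr A = LinearMap.trace ℂ H (A : H →ₗ[ℂ] H) := rfl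

/-- The functional `A ↦ Re Tr(q A)`. -/
def covector (q : H →L[ℂ] H) : (H →L[ℂ] H) →ₗ[ℝ] ℝ where
  toFun A := (tr (q * A)).re
  map_add' A B := by simp [mul_add]
  map_smul' r A := by
    rw [← Complex.coe_smul r A]; simp

theorem proj_mem {n : ℕ} {q : H →L[ℂ] H} (hq : q ∈ idempotents H n) :
    proj q ∈ grassmannian H n := by
  refine ⟨LinearMap.range (q : H →ₗ[ℂ] H), ?_, rfl⟩
  have h1 : IsIdempotentElem (q : H →ₗ[ℂ] H) := by
    have := congrArg (fun f : H →L[ℂ] H => (f : H →ₗ[ℂ] H)) hq.1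
    exact this
  have h2 := (LinearMap.IsIdempotentElem.isProj_range _ h1).trace
  have h3 := hq.2
  rw [h2] at h3
  exact_mod_cast h3

/-- The identification of the idempotents of trace `n` with the cotangent bundle of `G_n H`:
`q` corresponds to the covector `A ↦ Re Tr(q A)` at the image of `q`. -/
def toCotangent (n : ℕ) (q : idempotents H n) : Cotangent (grassmannian H n) :=
  ⟨⟨proj (q : H →L[ℂ] H), proj_mem q.2⟩,
    (covector (q : H →L[ℂ] H)).domRestrict (tangentSpace (grassmannian H n) (proj (q : H →L[ℂ] H)))⟩

/-- `I : A ↦ i A`. -/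
def complexI (_q : H →L[ℂ] H) : (H →L[ℂ] H) →L[ℝ] (H →L[ℂ] H) where
  toFun A := Complex.I • A
  map_add' A B := smul_add _ A B
  map_smul' r A := smul_comm _ r A
  cont := continuous_const_smul _

/-- `J : A ↦ i [A, q]`. -/
def complexJ (q : H →L[ℂ] H) : (H →L[ℂ] H) →L[ℝ] (H →L[ℂ] H) where
  toFun A := Complex.I • (A * q - q * A)
  map_add' A B := by
    rw [add_mul, mul_add, add_sub_add_comm, smul_add]
  map_smul' r A := by
    rw [smul_mul_assoc, mul_smul_comm, ← smul_sub]
    exact smul_comm _ r _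
  cont := by
    fun_prop

/-- The 2-form `Ω_q(A, B) = i c Tr(q [A, B])`, where the trace is normalized by the factor `c`. -/
def Omega (c : ℝ) (q : H →L[ℂ] H) : (H →L[ℂ] H) [⋀^Fin 2]→L[ℝ] ℂ where
  toFun v := Complex.I * (c * tr (q * (v 0 * v 1 - v 1 * v 0)))
  map_update_add' {inst} v i A B := by
    have : inst = instDecidableEqFin 2 := Subsingleton.elim _ _
    subst this
    fin_cases i <;> simp [add_mul, mul_add, mul_sub] <;> ring
  map_update_smul' {inst} v i r A := by
    have : inst = instDecidableEqFin 2 := Subsingleton.elim _ _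
    subst this
    rw [← Complex.coe_smul r A]
    fin_cases i <;> simp [mul_sub] <;> ring
  map_eq_zero_of_eq' v i j h hij := by
    have h01 : v 0 = v 1 := by
      fin_cases i <;> fin_cases j <;> simp_all
    rw [h01, sub_self, mul_zero, map_zero, mul_zero, mul_zero]
  cont := by
    fun_prop

theorem Omega_apply (c : ℝ) (q A B : H →L[ℂ] H) :
    Omega c q ![A, B] = Complex.I * (c * tr (q * (A * B - B * A))) := rfl

/-- The real part of `Ω`. -/
def reOmega (c : ℝ) (q : H →L[ℂ] H) : (H →L[ℂ] H) [⋀^Fin 2]→L[ℝ] ℝ :=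
  Complex.reCLM.compContinuousAlternatingMap (Omega c q)

/-- The imaginary part of `Ω`. -/
def imOmega (c : ℝ) (q : H →L[ℂ] H) : (H →L[ℂ] H) [⋀^Fin 2]→L[ℝ] ℝ :=
  Complex.imCLM.compContinuousAlternatingMap (Omega c q)

end Grassmannian

end CotGr

end

open CotGr

/-!
An idempotent `q` splits `H` into its image and its kernel, so operators become 2×2 block matrices,
and differentiating `q² = q` shows that tangent vectors at `q` are off-diagonal:
`q A + A q = A`. Everything rests on this block calculus. Products of two off-diagonal operators are
diagonal, products of three have trace zero, and `[·, q]` is an involution on off-diagonal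
operators, so that `J = i [·, q]` squares to `-1`.

*Charts.* Subspaces near the image and near the kernel of `q` are graphs of the two blocks of an
off-diagonal `T`, and the idempotent with this image and this kernel is
`graphChart q T = (1 + T) q (1 + T)⁻¹`. Its inverse is given by an explicit formula, smooth on a
neighbourhood in `B(H)` (`intertwiner_graphChart`, `graphChart_graphChartInv`), so the chart
parametrizes the idempotents (`isParam_graphChart`). For an orthogonal projection `p`, the adjoint
of `graphChart p T` is `graphChart p (-T*)`, so the skew-adjoint `T` parametrize the Grassmannian.
The differential of the chart commutes with multiplication by `i`, and it carries the constant
structure `J_q` at the centre to `J` (`graphChart_commutator`). Hence both structures are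
integrable.

*Cotangent bundle.* The idempotents with image `p H` are the `p + b` with `b` in the upper right
block, and the covector of such an idempotent at a tangent vector `A` of the Grassmannian is
`Re tr (b A)`. Writing `b = p B` with `B` tangent to the Grassmannian, this becomes
`Re tr (p B A)`, which is an inner product on tangent vectors (`tr_sq_pos`). Inverting its Gram
matrix in a chart of the Grassmannian gives the induced chart of the cotangent bundle
(`cotangentParam`). That it is a homeomorphism onto an open set of idempotents uses the formula
`proj q = q (q + q* - 1)⁻¹`, which makes `proj` smooth (`proj_eq`), and the fact that the
differential of a chart maps onto the tangent space (`IsParam.tangentSpace_eq`).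

*Symplectic form.* `Ω` is linear in `q`, and its exterior derivative on `B(H)` is a multiple of
`Tr (A [B, C])`, which vanishes on off-diagonal operators (`extDeriv_Omega`). Since exterior
derivatives commute with pullbacks, `Ω` is closed on the idempotents. It is non-degenerate because
the trace form is, and its coefficients in `I`-holomorphic charts are polynomials in the chart and
its derivatives, which are holomorphic. The Kähler metric at `p` is
`Re Ω (J A, A) = 2 c tr (p A A) > 0`. The Lagrangian conditions are computations with blocks.
-/

noncomputable section

namespace CotGr

/-! ### Idempotents and off-diagonal elements of a ring -/

section Ring

variable {R : Type*} [Ring R]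

/-- The graph chart of the set of idempotents centred at the idempotent `q`. For `T` off-diagonal
with respect to `q`, the lower left block of `T` is the linear map whose graph is the image of
`graphChart q T`, and the upper right block is the one whose graph is the kernel. The
domain of the chart is `IsUnit (1 + T)`: outside of it `Ring.inverse` is zero. -/
def graphChart (q T : R) : R := (1 + T) * q * Ring.inverse (1 + T)

/-- The operator intertwining `q` and `p`, equal to `p` on the image of `q` and to `1 - p`
on the kernel of `q`. -/
def intertwiner (q p : R) : R := p * q + (1 - p) * (1 - q)

/-- The diagonal part, with respect to `q`, of `intertwiner q p`. -/
def diagIntertwiner (q p : R) : R := q * p * q + (1 - q) * (1 - p) * (1 - q)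

/-- The inverse of `graphChart q`, on the idempotents `p` for which `intertwiner q p` and its
diagonal part are invertible. -/
def graphChartInv (q p : R) : R :=
  intertwiner q p * Ring.inverse (diagIntertwiner q p) - 1

theorem offDiag_mul_eq_zero {q A : R} (hq : q * q = q) (hA : q * A + A * q = A) :
    q * A * q = 0 := by
  have h := congrArg (q * ·) hA
  simp only [mul_add, ← mul_assoc, hq] at h
  simpa using h

theorem offDiag_compl_mul_eq_zero {q A : R} (hA : q * A + A * q = A) (hq : q * q = q) :
    (1 - q) * A * (1 - q) = 0 := by
  have h := offDiag_mul_eq_zero hq hA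
  have : (1 - q) * A * (1 - q) = A - (q * A + A * q) + q * A * q := by noncomm_ring
  rw [this, hA, h]; simp

theorem offDiag_of_blocks {q A : R} (h1 : q * A * q = 0) (h2 : (1 - q) * A * (1 - q) = 0) :
    q * A + A * q = A := by
  have : (1 - q) * A * (1 - q) = A - (q * A + A * q) + q * A * q := by noncomm_ring
  rw [h2, h1, add_zero] at this
  exact (sub_eq_zero.1 this.symm).symm

/-- Products of two off-diagonal elements are diagonal. -/
theorem offDiag_mul_commute {q A B : R} (hA : q * A + A * q = A) (hB : q * B + B * q = B) :
    Commute q (A * B) := by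
  have hA' : A * q = A - q * A := by rw [eq_sub_iff_add_eq, add_comm, hA]
  have hB' : q * B = B - B * q := by rw [eq_sub_iff_add_eq, hB]
  have h1 : q * (A * B) = A * B - A * q * B := by rw [hA']; noncomm_ring
  have h2 : A * B * q = A * B - A * (q * B) := by rw [hB']; noncomm_ring
  rw [Commute, SemiconjBy, h1, h2, mul_assoc]

/-- The reflection `2 q - 1` conjugates `1 + T` to `1 - T`. -/
theorem isUnit_one_sub_of_offDiag {q T : R} (hq : q * q = q) (hT : q * T + T * q = T)
    (hu : IsUnit (1 + T)) : IsUnit (1 - T) := by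
  have hs : (2 * q - 1) * (2 * q - 1) = 1 := by
    have : (2 * q - 1) * (2 * q - 1) = 4 * (q * q - q) + 1 := by noncomm_ring
    rw [this, hq]; simp
  have hsu : IsUnit (2 * q - 1) := ⟨⟨_, _, hs, hs⟩, rfl⟩
  have h0 := offDiag_mul_eq_zero hq hT
  have : 1 - T = (2 * q - 1) * (1 + T) * (2 * q - 1) := by
    have : (2 * q - 1) * (1 + T) * (2 * q - 1) =
      (2 * q - 1) * (2 * q - 1) + 4 * (q * T * q) - 2 * (q * T + T * q) + T := by noncomm_ring
    rw [this, h0, hT, hs]; noncomm_ring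
  rw [this]
  exact (hsu.mul hu).mul hsu

/-- Up to the factor `w = 1 - T²`, which commutes with `q`, the inverse of `1 + T` is `1 - T`. -/
theorem exists_inverse_one_add {q T : R} (hq : q * q = q) (hT : q * T + T * q = T)
    (hu : IsUnit (1 + T)) : ∃ w : Rˣ, (w : R) = (1 + T) * (1 - T) ∧ Commute q (w : R) ∧
      Commute q ((w⁻¹ : Rˣ) : R) ∧ Ring.inverse (1 + T) = (1 - T) * (w⁻¹ : Rˣ) ∧
      Ring.inverse (1 + T) = (w⁻¹ : Rˣ) * (1 - T) := by
  obtain ⟨v, hv⟩ := isUnit_one_sub_of_offDiag hq hT hu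
  obtain ⟨u, hu⟩ := hu
  have huv : u * v = v * u := by
    ext; simp only [Units.val_mul, hu, hv]; noncomm_ring
  have hc : Commute q ((u * v : Rˣ) : R) := by
    simp only [Units.val_mul, hu, hv]
    have : (1 + T) * (1 - T) = 1 - T * T := by noncomm_ring
    rw [this]
    exact (Commute.one_right q).sub_right (offDiag_mul_commute hT hT)
  refine ⟨u * v, by simp [hu, hv], hc, hc.units_inv_right, ?_, ?_⟩
  · rw [← hu, ← hv, Ring.inverse_unit, ← Units.val_mul]; simp
  · rw [← hu, ← hv, Ring.inverse_unit, ← Units.val_mul, huv]; simp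

theorem graphChart_mul_self {q T : R} (hq : q * q = q) (hu : IsUnit (1 + T)) :
    graphChart q T * graphChart q T = graphChart q T := by
  have h := Ring.inverse_mul_cancel _ hu
  calc graphChart q T * graphChart q T
      = (1 + T) * q * (Ring.inverse (1 + T) * (1 + T)) * q * Ring.inverse (1 + T) := by
        simp only [graphChart, mul_assoc]
    _ = graphChart q T := by rw [h, mul_one, mul_assoc _ q q, hq, graphChart]

@[simp] theorem graphChart_zero (q : R) : graphChart q 0 = q := by simp [graphChart]

theorem one_sub_mul_graphChart {q T : R} (hq : q * q = q) (hT : q * T + T * q = T)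
    (hu : IsUnit (1 + T)) : (1 - T) * graphChart q T = q * (1 - T) := by
  obtain ⟨w, hw, hc, hc', -, hi⟩ := exists_inverse_one_add hq hT hu
  have : (1 - T) * (1 + T) = w := by rw [hw]; noncomm_ring
  rw [graphChart, hi, ← mul_assoc, ← mul_assoc, ← mul_assoc, this, hc.symm.eq, mul_assoc q,
    Units.mul_inv, mul_one]

theorem one_sub_mul_intertwiner_graphChart {q T : R} (hq : q * q = q) (hT : q * T + T * q = T)
    (hu : IsUnit (1 + T)) : (1 - T) * intertwiner q (graphChart q T) = 1 := by
  have h := one_sub_mul_graphChart hq hT hu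
  have h1 : (1 - T) * intertwiner q (graphChart q T) =
      (1 - T) * graphChart q T * q + ((1 - T) - (1 - T) * graphChart q T) * (1 - q) := by
    rw [intertwiner]; noncomm_ring
  have h2 : q * (1 - T) * q + ((1 - T) - q * (1 - T)) * (1 - q) =
    q * q + (1 - q) * (1 - q) - q * T * q - (1 - q) * T * (1 - q) := by noncomm_ring
  rw [h1, h, h2, offDiag_mul_eq_zero hq hT, offDiag_compl_mul_eq_zero hT hq]
  have : (1 - q) * (1 - q) = 1 - q + (q * q - q) := by noncomm_ring
  rw [this, hq]; simp

theorem diagIntertwiner_eq {q p : R} (hq : q * q = q) : diagIntertwiner q p =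
    q * intertwiner q p * q + (1 - q) * intertwiner q p * (1 - q) := by
  have h3 : q * (1 - q) = 0 := by rw [mul_sub, hq]; simp
  have h4 : (1 - q) * q = 0 := by rw [sub_mul, hq]; simp
  have h5 : (1 - q) * (1 - q) = 1 - q := by rw [mul_sub, h4]; simp
  simp only [intertwiner, diagIntertwiner, mul_add, add_mul]
  simp only [mul_assoc, hq, h3, h4, h5, mul_zero]
  simp

theorem intertwiner_graphChart {q T : R} (hq : q * q = q) (hT : q * T + T * q = T)
    (hu : IsUnit (1 + T)) : IsUnit (intertwiner q (graphChart q T)) ∧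
      IsUnit (diagIntertwiner q (graphChart q T)) ∧
      graphChartInv q (graphChart q T) = T := by
  have h1 := one_sub_mul_intertwiner_graphChart hq hT hu
  obtain ⟨v, hv⟩ := isUnit_one_sub_of_offDiag hq hT hu
  obtain ⟨w, hw, hc, hc', hi, -⟩ := exists_inverse_one_add hq hT hu
  have h2 : intertwiner q (graphChart q T) = (v⁻¹ : Rˣ) := by
    rw [← hv] at h1
    exact Units.eq_inv_of_mul_eq_one_left h1
  have h3 : ((v⁻¹ : Rˣ) : R) = (1 + T) * (w⁻¹ : Rˣ) := by
    have h : (v : R) * (1 + T) = w := by rw [hv, hw]; noncomm_ring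
    have h' : (v : R) * ((1 + T) * (w⁻¹ : Rˣ)) = 1 := by rw [← mul_assoc, h, Units.mul_inv]
    exact (Units.eq_inv_of_mul_eq_one_left h').symm
  have h4 : diagIntertwiner q (graphChart q T) = (w⁻¹ : Rˣ) := by
    have e1 : q * ((1 + T) * (w⁻¹ : Rˣ)) * q = q * (1 + T) * q * (w⁻¹ : Rˣ) := by
      simp only [mul_assoc, hc'.eq]
    have e2 : (1 - q) * ((1 + T) * (w⁻¹ : Rˣ)) * (1 - q) =
        (1 - q) * (1 + T) * (1 - q) * (w⁻¹ : Rˣ) := by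
      simp only [mul_assoc, ((Commute.one_left _).sub_left hc').eq]
    have e3 : q * (1 + T) * q + (1 - q) * (1 + T) * (1 - q) =
      q * T * q + (1 - q) * T * (1 - q) + 2 * (q * q - q) + 1 := by noncomm_ring
    rw [diagIntertwiner_eq hq, h2, h3, e1, e2, ← add_mul, e3, offDiag_mul_eq_zero hq hT,
      offDiag_compl_mul_eq_zero hT hq, hq]
    simp
  refine ⟨h2 ▸ (v⁻¹).isUnit, h4 ▸ (w⁻¹).isUnit, ?_⟩
  rw [graphChartInv, h4, h2, h3, Ring.inverse_unit, inv_inv, mul_assoc, Units.inv_mul]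
  simp

theorem graphChart_graphChartInv {q p : R} (hq : q * q = q) (hp : p * p = p)
    (h : IsUnit (intertwiner q p)) (hd : IsUnit (diagIntertwiner q p)) :
    q * graphChartInv q p + graphChartInv q p * q = graphChartInv q p ∧
      IsUnit (1 + graphChartInv q p) ∧ graphChart q (graphChartInv q p) = p := by
  have h3 : q * (1 - q) = 0 := by rw [mul_sub, hq]; simp
  have h4 : (1 - q) * q = 0 := by rw [sub_mul, hq]; simp
  have h5 : (1 - q) * (1 - q) = 1 - q := by rw [mul_sub, h4]; simp
  have hdq : q * diagIntertwiner q p = diagIntertwiner q p * q := by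
    simp only [diagIntertwiner, mul_add, add_mul]
    simp only [mul_assoc, hq, h4]
    simp only [← mul_assoc, hq, h3]
    simp
  have hdq1 : q * diagIntertwiner q p = q * intertwiner q p * q := by
    rw [diagIntertwiner_eq hq, mul_add]
    simp only [← mul_assoc, hq, h3]
    simp
  have hdq2 : (1 - q) * diagIntertwiner q p = (1 - q) * intertwiner q p * (1 - q) := by
    rw [diagIntertwiner_eq hq, mul_add]
    simp only [← mul_assoc, h5, h4]
    simp
  have hi : p * intertwiner q p = intertwiner q p * q := by
    have h6 : p * (1 - p) = 0 := by rw [mul_sub, hp]; simp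
    simp only [intertwiner, mul_add, add_mul]
    simp only [mul_assoc, hq, h4]
    simp only [← mul_assoc, hp, h6]
    simp
  obtain ⟨a, ha⟩ := h
  obtain ⟨d, hd⟩ := hd
  have hcd : Commute q (d : R) := by rw [hd]; exact hdq
  have hcd' : Commute q ((d⁻¹ : Rˣ) : R) := hcd.units_inv_right
  have hg : graphChartInv q p = a * (d⁻¹ : Rˣ) - 1 := by
    rw [graphChartInv, ← ha, ← hd, Ring.inverse_unit]
  have hg1 : 1 + graphChartInv q p = ((a * d⁻¹ : Rˣ) : R) := by
    rw [hg]; simp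
  rw [← ha, ← hd] at hdq1 hdq2
  refine ⟨offDiag_of_blocks ?_ ?_, hg1 ▸ (a * d⁻¹).isUnit, ?_⟩
  · rw [hg, mul_sub, sub_mul, mul_one, hq, ← mul_assoc, mul_assoc _ _ q, ← hcd'.eq, ← mul_assoc,
      ← hdq1, mul_assoc, Units.mul_inv, mul_one, sub_self]
  · have hc2 : Commute (1 - q) ((d⁻¹ : Rˣ) : R) := (Commute.one_left _).sub_left hcd'
    rw [hg, mul_sub (1 - q), mul_one, sub_mul _ (1 - q) (1 - q), h5, ← mul_assoc,
      mul_assoc _ _ (1 - q), ← hc2.eq, ← mul_assoc, ← hdq2, mul_assoc, Units.mul_inv,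
      mul_one, sub_self]
  · rw [graphChart, hg1, Ring.inverse_unit, mul_inv_rev, inv_inv, Units.val_mul, Units.val_mul,
      mul_assoc (a : R), ← hcd'.eq, ← mul_assoc, ← mul_assoc, ha, ← hi, ← ha,
      mul_assoc (p * (a : R)), Units.inv_mul, mul_one, mul_assoc, Units.mul_inv, mul_one]

/-- The differential `D` of the chart at `T` intertwines the operators `[·, q]` at the centre of the
chart and `[·, graphChart q T]` at the point with coordinate `T`. -/
theorem graphChart_commutator {q T S : R} (hq : q * q = q) (hT : q * T + T * q = T)
    (hS : q * S + S * q = S) (hu : IsUnit (1 + T)) {D : R → R}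
    (hD : ∀ S, D S = S * Ring.inverse (1 + T) * graphChart q T -
      graphChart q T * (S * Ring.inverse (1 + T))) :
    D S * graphChart q T - graphChart q T * D S = D (S * q - q * S) := by
  obtain ⟨w, hw, hc, hc', -, hi⟩ := exists_inverse_one_add hq hT hu
  obtain ⟨u, hu⟩ := hu
  have hchart : graphChart q T = u * q * (u⁻¹ : Rˣ) := by
    rw [graphChart, ← hu, Ring.inverse_unit]
  rw [← hu, Ring.inverse_unit] at hi hD
  have hD' (X : R) : D X = u * ((u⁻¹ : Rˣ) * X * q - q * ((u⁻¹ : Rˣ) * X)) * (u⁻¹ : Rˣ) := by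
    rw [hD, hchart]
    simp only [mul_sub, sub_mul, ← mul_assoc, Units.mul_inv, one_mul]
    rw [mul_assoc (X : R), Units.inv_mul, mul_one]
  have hTq : q * (T * q - q * T) + (T * q - q * T) * q = T * q - q * T := by
    have : q * (T * q - q * T) + (T * q - q * T) * q = T * (q * q) - q * q * T := by noncomm_ring
    rw [this, hq]
  have hcomm : Commute q (((u⁻¹ : Rˣ) * q - q * (u⁻¹ : Rˣ)) * S) := by
    have : ((u⁻¹ : Rˣ) * q - q * (u⁻¹ : Rˣ)) * S = -((w⁻¹ : Rˣ) * ((T * q - q * T) * S)) := by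
      rw [hi, ← mul_assoc q, hc'.eq]; noncomm_ring
    rw [this]
    exact (hc'.mul_right (offDiag_mul_commute hTq hS)).neg_right
  have hsub : (u⁻¹ : Rˣ) * (S * q - q * S) = (u⁻¹ : Rˣ) * S * q - q * ((u⁻¹ : Rˣ) * S) -
      ((u⁻¹ : Rˣ) * q - q * (u⁻¹ : Rˣ)) * S := by noncomm_ring
  rw [hD' (S * q - q * S), hsub, sub_mul _ _ q, mul_sub q, hcomm.eq, sub_sub_sub_cancel_right,
    hD' S, hchart]
  generalize (u⁻¹ : Rˣ) * S * q - q * ((u⁻¹ : Rˣ) * S) = Z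
  rw [mul_sub (u : R), sub_mul _ _ ((u⁻¹ : Rˣ) : R)]
  congr 1
  · simp only [mul_assoc, Units.inv_mul_cancel_left]
  · simp only [mul_assoc, Units.inv_mul_cancel_left]

end Ring

/-! ### Parametrizations of submanifolds -/

section Param

theorem isOpenEmbedding_restrict_of_continuous_inverse {E F : Type*} [TopologicalSpace E]
    [TopologicalSpace F] {S : Set E} {U : Set F} {ψ : F → E}
    (hψ : ContinuousOn ψ U) (hm : Set.MapsTo ψ U S) {O : Set S} (hO : IsOpen O) {φ : S → F}
    (hφ : ContinuousOn φ O) (hl : ∀ u, ∀ hu : u ∈ U, (⟨ψ u, hm hu⟩ : S) ∈ O ∧ φ ⟨ψ u, hm hu⟩ = u)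
    (hr : ∀ y ∈ O, φ y ∈ U ∧ ψ (φ y) = y) :
    Topology.IsOpenEmbedding (hm.restrict ψ U S) := by
  refine .of_continuous_injective_isOpenMap (hψ.mapsToRestrict hm) ?_ ?_
  · rintro ⟨u, hu⟩ ⟨v, hv⟩ h
    have h' : (⟨ψ u, hm hu⟩ : S) = ⟨ψ v, hm hv⟩ := h
    exact Subtype.ext ((hl u hu).2.symm.trans ((congrArg φ h').trans (hl v hv).2))
  · rintro _ ⟨V, hV, rfl⟩
    convert hφ.isOpen_inter_preimage hO hV using 1
    ext y
    constructor
    · rintro ⟨⟨u, hu⟩, huV, rfl⟩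
      refine ⟨(hl u hu).1, ?_⟩
      have : φ (hm.restrict ψ U S ⟨u, hu⟩) = u := (hl u hu).2
      rw [Set.mem_preimage, this]
      exact huV
    · rintro ⟨hyO, hyV⟩
      exact ⟨⟨φ y, (hr y hyO).1⟩, hyV, Subtype.ext (hr y hyO).2⟩

variable {E : Type*} [NormedAddCommGroup E] [NormedSpace ℝ E]
variable {F : Type*} [NormedAddCommGroup F] [NormedSpace ℝ F]
variable {W : Type*} [NormedAddCommGroup W] [NormedSpace ℝ W]

theorem IsParam.of_smooth_inverse {S : Set E} {U : Set F} {ψ : F → E} {O : Set E} {φ : E → F}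
    (hU : IsOpen U) (hψ : ContDiffOn ℝ ∞ ψ U) (hO : IsOpen O) (hφ : ContDiffOn ℝ ∞ φ O)
    (hm : Set.MapsTo ψ U S) (hmO : Set.MapsTo ψ U O) (hl : ∀ u ∈ U, φ (ψ u) = u)
    (hr : ∀ y ∈ S, y ∈ O → φ y ∈ U ∧ ψ (φ y) = y) : IsParam S U ψ where
  isOpen := hU
  contDiffOn := hψ
  injective_fderiv u hu := by
    have h1 : DifferentiableAt ℝ ψ u := (hψ.contDiffAt (hU.mem_nhds hu)).differentiableAt (by simp)
    have h2 : DifferentiableAt ℝ φ (ψ u) :=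
      (hφ.contDiffAt (hO.mem_nhds (hmO hu))).differentiableAt (by simp)
    have h3 : fderiv ℝ (φ ∘ ψ) u = ContinuousLinearMap.id ℝ F := by
      have : φ ∘ ψ =ᶠ[𝓝 u] id := by
        filter_upwards [hU.mem_nhds hu] with v hv using hl v hv
      rw [this.fderiv_eq, fderiv_id]
    rw [fderiv_comp _ h2 h1] at h3
    exact Function.LeftInverse.injective (g := fderiv ℝ φ (ψ u)) fun v => congrArg (· v) h3
  mapsTo := hm
  isOpenEmbedding := by
    refine isOpenEmbedding_restrict_of_continuous_inverse hψ.continuousOn hm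
      (O := Subtype.val ⁻¹' O) (hO.preimage continuous_subtype_val) (φ := fun y => φ y)
      (hφ.continuousOn.comp continuous_subtype_val.continuousOn fun _ h => h)
      (fun u hu => ⟨hmO hu, hl u hu⟩) fun y hy => hr y y.2 hy

theorem IsParam.contDiffAt {S : Set E} {U : Set F} {ψ : F → E} (h : IsParam S U ψ) {u : F}
    (hu : u ∈ U) : ContDiffAt ℝ ∞ ψ u := h.contDiffOn.contDiffAt (h.isOpen.mem_nhds hu)

theorem IsParam.differentiableAt {S : Set E} {U : Set F} {ψ : F → E} (h : IsParam S U ψ) {u : F}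
    (hu : u ∈ U) : DifferentiableAt ℝ ψ u := (h.contDiffAt hu).differentiableAt (by simp)

theorem IsParam.contDiffOn_fderiv {S : Set E} {U : Set F} {ψ : F → E} (h : IsParam S U ψ) :
    ContDiffOn ℝ ∞ (fderiv ℝ ψ) U :=
  h.contDiffOn.fderiv_of_isOpen h.isOpen (by simp)

theorem IsParam.contDiffOn_fderiv_apply {S : Set E} {U : Set F} {ψ : F → E} (h : IsParam S U ψ)
    (v : F) : ContDiffOn ℝ ∞ (fun u => fderiv ℝ ψ u v) U :=
  h.contDiffOn_fderiv.clm_apply contDiffOn_const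

theorem IsParam.fderiv_mem {S : Set E} {U : Set F} {ψ : F → E} (h : IsParam S U ψ) {u : F}
    (hu : u ∈ U) (v : F) : fderiv ℝ ψ u v ∈ tangentSpace S (ψ u) := by
  refine Submodule.subset_span ⟨fun t : ℝ => ψ (u + t • v), ?_, ?_, by simp, ?_⟩
  · have h1 : ContDiffAt ℝ ∞ ψ (u + (0 : ℝ) • v) := by simpa using h.contDiffAt hu
    exact h1.comp (0 : ℝ) (by fun_prop)
  · have hc : ContinuousAt (fun t : ℝ => u + t • v) 0 := by fun_prop
    have : U ∈ 𝓝 (u + (0 : ℝ) • v) := by simpa using h.isOpen.mem_nhds hu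
    filter_upwards [hc.preimage_mem_nhds this] with t ht using h.mapsTo ht
  · have h1 : HasFDerivAt ψ (fderiv ℝ ψ u) (u + (0 : ℝ) • v) := by
      simpa using (h.differentiableAt hu).hasFDerivAt
    have h2 : HasDerivAt (fun t : ℝ => u + t • v) v 0 := by
      simpa using ((hasDerivAt_id (0 : ℝ)).smul_const v).const_add u
    exact h1.comp_hasDerivAt (0 : ℝ) h2

/-- The differential of a parametrization maps onto the tangent space. A curve in `S` lifts to a
continuous curve in the domain; the lift is differentiable by the inverse function theorem, applied
to the composite of the parametrization with a linear retraction of its differential. -/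
theorem IsParam.tangentSpace_eq [FiniteDimensional ℝ E] [FiniteDimensional ℝ F]
    {S : Set E} {U : Set F} {ψ : F → E}
    (h : IsParam S U ψ) {u : F} (hu : u ∈ U) :
    tangentSpace S (ψ u) = LinearMap.range (fderiv ℝ ψ u : F →ₗ[ℝ] E) := by
  have := FiniteDimensional.complete ℝ F
  refine le_antisymm (Submodule.span_le.2 ?_) ?_
  swap
  · rintro _ ⟨v, rfl⟩
    exact h.fderiv_mem hu v
  rintro v ⟨γ, hγ, hγS, hγ0, hγd⟩
  obtain ⟨l, hl⟩ := LinearMap.exists_leftInverse_of_injective (fderiv ℝ ψ u : F →ₗ[ℝ] E)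
    (LinearMap.ker_eq_bot.2 (h.injective_fderiv u hu))
  let L : E →L[ℝ] F := LinearMap.toContinuousLinearMap l
  have hL : L ∘L fderiv ℝ ψ u = ContinuousLinearMap.id ℝ F := by
    ext w; exact congrArg (· w) hl
  have hf : HasStrictFDerivAt (fun w => L (ψ w))
      ((ContinuousLinearEquiv.refl ℝ F : F ≃L[ℝ] F) : F →L[ℝ] F) u := by
    have := L.hasStrictFDerivAt.comp u ((h.contDiffAt hu).hasStrictFDerivAt (by simp))
    rw [hL] at this
    exact this
  set g := hf.localInverse (fun w => L (ψ w)) (ContinuousLinearEquiv.refl ℝ F) u with hg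
  have hgd : HasFDerivAt g (ContinuousLinearMap.id ℝ F) (L (ψ u)) :=
    hf.to_localInverse.hasFDerivAt
  -- near `u`, the parametrization is inverted on its image by the retraction `g ∘ L`
  have hret : ∀ᶠ t in 𝓝 (0 : ℝ), γ t = ψ (g (L (γ t))) := by
    have h1 : ∀ᶠ w in 𝓝 u, g (L (ψ w)) = w := hf.eventually_left_inverse
    obtain ⟨N, hN, hNo, huN⟩ := eventually_nhds_iff.1 h1
    have h2 : IsOpen (h.mapsTo.restrict ψ U S '' (Subtype.val ⁻¹' N)) :=
      h.isOpenEmbedding.isOpenMap _ (hNo.preimage continuous_subtype_val)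
    obtain ⟨O, hO, hOeq⟩ := h2
    have h3 : γ 0 ∈ O := by
      have : (⟨ψ u, h.mapsTo hu⟩ : S) ∈ Subtype.val ⁻¹' O := by
        rw [hOeq]; exact ⟨⟨u, hu⟩, huN, rfl⟩
      rw [hγ0]; exact this
    filter_upwards [hγS, hγ.continuousAt.preimage_mem_nhds (hO.mem_nhds h3)] with t ht htO
    have : (⟨γ t, ht⟩ : S) ∈ Subtype.val ⁻¹' O := htO
    rw [hOeq] at this
    obtain ⟨⟨w, hw⟩, hwN, hwt⟩ := this
    have hwt' : ψ w = γ t := congrArg Subtype.val hwt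
    rw [← hwt', hN w hwN]
  have hLγ : HasDerivAt (fun t => L (γ t)) (L v) 0 := L.hasFDerivAt.comp_hasDerivAt _ hγd
  have hLγ0 : L (γ 0) = L (ψ u) := by rw [hγ0]
  have hgL : HasDerivAt (fun t => g (L (γ t))) (L v) 0 := by
    have := HasFDerivAt.comp_hasDerivAt (0 : ℝ) (hLγ0 ▸ hgd) hLγ
    simpa [Function.comp_def] using this
  have hg0 : g (L (γ 0)) = u := by
    rw [hLγ0]; exact hf.eventually_left_inverse.self_of_nhds
  have hd : HasDerivAt (fun t => ψ (g (L (γ t)))) (fderiv ℝ ψ u (L v)) 0 := by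
    have h1 : HasFDerivAt ψ (fderiv ℝ ψ u) (g (L (γ 0))) := by
      rw [hg0]; exact (h.differentiableAt hu).hasFDerivAt
    exact h1.comp_hasDerivAt (0 : ℝ) hgL
  have := (hd.congr_of_eventuallyEq hret).unique hγd
  exact ⟨L v, this⟩

/-- A parametrization has a continuous inverse on its image. -/
theorem IsParam.exists_continuousOn_inverse {S : Set E} {U : Set F} {ψ : F → E}
    (h : IsParam S U ψ) :
    ∃ σ : S → F, IsOpen {y : S | (y : E) ∈ ψ '' U} ∧ ContinuousOn σ {y : S | (y : E) ∈ ψ '' U} ∧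
      (∀ y : S, (y : E) ∈ ψ '' U → σ y ∈ U ∧ ψ (σ y) = y) ∧
      ∀ u, ∀ hu : u ∈ U, σ ⟨ψ u, h.mapsTo hu⟩ = u := by
  classical
  let σ : S → F := fun y => if hy : (y : E) ∈ ψ '' U then hy.choose else 0
  have h1 (y : S) (hy : (y : E) ∈ ψ '' U) : σ y ∈ U ∧ ψ (σ y) = y := by
    simp only [σ, dif_pos hy]; exact hy.choose_spec
  have h2 (u) (hu : u ∈ U) : σ ⟨ψ u, h.mapsTo hu⟩ = u := by
    obtain ⟨h3, h4⟩ := h1 ⟨ψ u, h.mapsTo hu⟩ ⟨u, hu, rfl⟩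
    have h5 : (⟨σ ⟨ψ u, h.mapsTo hu⟩, h3⟩ : U) = ⟨u, hu⟩ :=
      h.isOpenEmbedding.injective (Subtype.ext h4)
    exact congrArg Subtype.val h5
  have h3 (V : Set F) (hV : IsOpen V) : IsOpen ({y : S | (y : E) ∈ ψ '' U} ∩ σ ⁻¹' V) := by
    convert h.isOpenEmbedding.isOpenMap _ (hV.preimage continuous_subtype_val) using 1
    ext y
    constructor
    · rintro ⟨hy, hyV⟩
      obtain ⟨h4, h5⟩ := h1 y hy
      exact ⟨⟨σ y, h4⟩, hyV, Subtype.ext h5⟩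
    · rintro ⟨⟨u, hu⟩, huV, rfl⟩
      refine ⟨⟨u, hu, rfl⟩, ?_⟩
      have : σ (h.mapsTo.restrict ψ U S ⟨u, hu⟩) = u := h2 u hu
      rw [Set.mem_preimage, this]
      exact huV
  have h4 : IsOpen {y : S | (y : E) ∈ ψ '' U} := by simpa using h3 _ isOpen_univ
  exact ⟨σ, h4, (continuousOn_open_iff h4).2 h3, h1, h2⟩

/-- A translate of a subspace is parametrized by linear coordinates on the subspace. -/
theorem isParam_affine [FiniteDimensional ℝ E] [FiniteDimensional ℝ F] {S : Set E}
    {K : Submodule ℝ E} {x : E} (hS : ∀ y, y ∈ S ↔ y - x ∈ K) (e : F ≃ₗ[ℝ] K) :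
    IsParam S Set.univ (fun u => x + (e u : E)) := by
  obtain ⟨l, hl⟩ := LinearMap.exists_leftInverse_of_injective
    (K.subtype ∘ₗ (e : F →ₗ[ℝ] K)) (LinearMap.ker_eq_bot.2
      (K.injective_subtype.comp e.injective))
  have hl' (u : F) : l (e u : E) = u := congrArg (· u) hl
  let e' : F →L[ℝ] E := LinearMap.toContinuousLinearMap (K.subtype ∘ₗ (e : F →ₗ[ℝ] K))
  let l' : E →L[ℝ] F := LinearMap.toContinuousLinearMap l
  refine IsParam.of_smooth_inverse (O := Set.univ) (φ := fun y => l' (y - x)) isOpen_univ ?_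
    isOpen_univ ?_ ?_ (Set.mapsTo_univ _ _) ?_ ?_
  · exact (contDiff_const.add e'.contDiff).contDiffOn
  · exact (l'.contDiff.comp (contDiff_id.sub contDiff_const)).contDiffOn
  · intro u _
    rw [hS]; simp
  · intro u _
    change l (x + (e u : E) - x) = u
    simpa using hl' u
  · intro y hy _
    refine ⟨trivial, ?_⟩
    change x + (e (l (y - x)) : E) = y
    have : (y - x) = (e (e.symm ⟨y - x, (hS y).1 hy⟩) : E) := by simp
    rw [this, hl', ← this]; simp

theorem isSubmanifold_affine [FiniteDimensional ℝ E] {S : Set E} {K : Submodule ℝ E}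
    (hS : ∀ x ∈ S, ∀ y, y ∈ S ↔ y - x ∈ K) : IsSubmanifold (Module.finrank ℝ K) S := by
  intro x hx
  have e : EuclideanSpace ℝ (Fin (Module.finrank ℝ K)) ≃ₗ[ℝ] K :=
    LinearEquiv.ofFinrankEq _ _ (by simp)
  exact ⟨_, _, isParam_affine (hS x hx) e, 0, trivial, by simp⟩

theorem tangentSpace_affine [FiniteDimensional ℝ E] {S : Set E} {K : Submodule ℝ E} {x : E}
    (hS : ∀ y, y ∈ S ↔ y - x ∈ K) : tangentSpace S x = K := by
  have h := isParam_affine hS (LinearEquiv.refl ℝ K)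
  have h1 := h.tangentSpace_eq (u := 0) trivial
  have h2 (u : K) : fderiv ℝ (fun u : K => x + ((LinearEquiv.refl ℝ K u : K) : E)) u =
      K.subtypeL := by
    exact (K.subtypeL.hasFDerivAt.const_add x).fderiv
  rw [h2] at h1
  simpa using h1

theorem cotangent_ext {S : Set E} {θ θ' : Cotangent S} (h1 : (θ.1 : E) = θ'.1)
    (h2 : ∀ A h h', θ.2 ⟨A, h⟩ = θ'.2 ⟨A, h'⟩) : θ = θ' := by
  obtain ⟨⟨x, hx⟩, ξ⟩ := θ
  obtain ⟨⟨y, hy⟩, ζ⟩ := θ'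
  obtain rfl : x = y := h1
  congr 1
  ext ⟨A, hA⟩
  exact h2 A hA hA

theorem cotangent_congr {S : Set E} {θ θ' : Cotangent S} (h : θ = θ') :
    (θ.1 : E) = θ'.1 ∧ ∀ A h h', θ.2 ⟨A, h⟩ = θ'.2 ⟨A, h'⟩ := by
  subst h
  exact ⟨rfl, fun _ _ _ => rfl⟩

/-- A map into a space of alternating 2-forms is smooth as soon as all its coefficients are. -/
theorem contDiffOn_alternating_of_apply {D : Type*} [NormedAddCommGroup D] [NormedSpace ℝ D]
    [FiniteDimensional ℝ F] [FiniteDimensional ℝ W] {U : Set D} {f : D → F [⋀^Fin 2]→L[ℝ] W}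
    (h : ∀ v w, ContDiffOn ℝ ∞ (fun u => f u ![v, w]) U) : ContDiffOn ℝ ∞ f U := by
  let b := Module.finBasis ℝ F
  let l : (F [⋀^Fin 2]→L[ℝ] W) →ₗ[ℝ] (Fin (Module.finrank ℝ F) → Fin (Module.finrank ℝ F) → W) :=
    { toFun σ i j := σ ![b i, b j]
      map_add' _ _ := rfl
      map_smul' _ _ := rfl }
  have hl : Function.Injective l := by
    intro σ τ hστ
    have : σ.toAlternatingMap = τ.toAlternatingMap := by
      refine Module.Basis.ext_alternating b fun v _ => ?_
      have h2 : (fun i => b (v i)) = ![b (v 0), b (v 1)] := by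
        ext i; fin_cases i <;> rfl
      rw [h2]
      exact congrFun (congrFun hστ (v 0)) (v 1)
    exact ContinuousAlternatingMap.toAlternatingMap_injective this
  obtain ⟨r, hr⟩ := LinearMap.exists_leftInverse_of_injective l (LinearMap.ker_eq_bot.2 hl)
  let r' := LinearMap.toContinuousLinearMap r
  have hf : f = fun u => r' (fun i j => f u ![b i, b j]) := by
    funext u; exact (congrArg (· (f u)) hr).symm
  rw [hf]
  refine r'.contDiff.comp_contDiffOn ?_
  exact contDiffOn_pi.2 fun i => contDiffOn_pi.2 fun j => h _ _

/-- A complex structure on a real vector space is standard in suitable coordinates. -/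
theorem exists_linearEquiv_intertwining [FiniteDimensional ℝ W] (j : W →ₗ[ℝ] W)
    (hj : ∀ w, j (j w) = -w) : ∃ (m : ℕ) (e : EuclideanSpace ℂ (Fin m) ≃ₗ[ℝ] W),
      ∀ v, e (Complex.I • v) = j (e v) := by
  let a : ℂ →ₐ[ℝ] Module.End ℝ W := Complex.lift ⟨j, by ext w; exact hj w⟩
  have haI : a Complex.I = j := by simp [a]
  let _ : Module ℂ W := Module.compHom W a.toRingHom
  have hsmul (z : ℂ) (w : W) : z • w = a z w := rfl
  have : IsScalarTower ℝ ℂ W := ⟨fun r z w => by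
    rw [hsmul, hsmul, map_smul]; rfl⟩
  have : FiniteDimensional ℂ W := FiniteDimensional.right ℝ ℂ W
  let e : EuclideanSpace ℂ (Fin (Module.finrank ℂ W)) ≃ₗ[ℂ] W :=
    LinearEquiv.ofFinrankEq _ _ (by simp)
  refine ⟨_, e.restrictScalars ℝ, fun v => ?_⟩
  rw [← haI, ← hsmul]
  exact e.map_smul _ _

end Param

/-! ### Smoothness of the graph chart -/

section NormedRing

theorem isOpen_isUnit_comp {R X : Type*} [NormedRing R] [CompleteSpace R] [TopologicalSpace X]
    {f : X → R} (hf : Continuous f) :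
    IsOpen {x | IsUnit (f x)} := Units.isOpen.preimage hf

/-- Tangent vectors to a set of idempotents are off-diagonal. -/
theorem offDiag_of_mem_tangentSpace {R : Type*} [NormedRing R] [NormedAlgebra ℝ R] {S : Set R}
    (hS : ∀ p ∈ S, p * p = p) {q A : R} (hA : A ∈ tangentSpace S q) : q * A + A * q = A := by
  refine Submodule.span_induction ?_ (by simp) ?_ ?_ hA
  · rintro v ⟨γ, hγ, hγS, rfl, hv⟩
    have h1 := hv.mul hv
    have h2 : (fun t => γ t * γ t) =ᶠ[𝓝 0] γ := by
      filter_upwards [hγS] with t ht using hS _ ht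
    have h3 := h1.unique (hv.congr_of_eventuallyEq h2)
    rw [add_comm]; exact h3
  · intro A B _ _ hA hB
    rw [mul_add, add_mul, add_add_add_comm, hA, hB]
  · intro r A _ hA
    rw [mul_smul_comm, smul_mul_assoc, ← smul_add, hA]

variable {R : Type*} [NormedRing R] [NormedAlgebra ℝ R] [CompleteSpace R]

theorem contDiffAt_inverse_comp {F : Type*} [NormedAddCommGroup F] [NormedSpace ℝ F] {f : F → R}
    {x : F} (hf : ContDiffAt ℝ ∞ f x) (hx : IsUnit (f x)) :
    ContDiffAt ℝ ∞ (fun y => Ring.inverse (f y)) x := by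
  obtain ⟨u, hu⟩ := hx
  have h := contDiffAt_ringInverse ℝ (n := ∞) u
  rw [hu] at h
  exact h.comp x hf

theorem contDiffOn_graphChart (q : R) :
    ContDiffOn ℝ ∞ (graphChart q) {T | IsUnit (1 + T)} := fun T hT => by
  refine ContDiffAt.contDiffWithinAt ?_
  exact (((contDiff_const.add contDiff_id).mul contDiff_const).contDiffAt).mul
    (contDiffAt_inverse_comp (contDiff_const.add contDiff_id).contDiffAt hT)

theorem hasFDerivAt_graphChart (q T : R) (hT : IsUnit (1 + T)) :
    ∃ D : R →L[ℝ] R, HasFDerivAt (graphChart q) D T ∧ ∀ S,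
      D S = S * Ring.inverse (1 + T) * graphChart q T -
        graphChart q T * (S * Ring.inverse (1 + T)) := by
  obtain ⟨u, hu⟩ := hT
  have h0 : HasFDerivAt (fun T : R => 1 + T) (ContinuousLinearMap.id ℝ R) T :=
    (hasFDerivAt_id T).const_add 1
  have h1 : HasFDerivAt (Ring.inverse : R → R)
      (-ContinuousLinearMap.mulLeftRight ℝ R ↑u⁻¹ ↑u⁻¹) (1 + T) := by
    rw [← hu]; exact hasFDerivAt_ringInverse u
  have h2 := (h0.mul_const' q).mul' (h1.comp T h0)
  refine ⟨_, h2, fun S => ?_⟩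
  simp [graphChart, ← hu, mul_assoc]
  abel

theorem contDiffOn_graphChartInv (q : R) : ContDiffOn ℝ ∞ (graphChartInv q)
    {p | IsUnit (diagIntertwiner q p)} := fun p hp => by
  refine ContDiffAt.contDiffWithinAt ?_
  have h1 : ContDiff ℝ ∞ (intertwiner q) := by unfold intertwiner; fun_prop
  have h2 : ContDiff ℝ ∞ (diagIntertwiner q) := by unfold diagIntertwiner; fun_prop
  exact (h1.contDiffAt.mul (contDiffAt_inverse_comp h2.contDiffAt hp)).sub contDiffAt_const

/-- The restriction of the graph chart to a space `K` of off-diagonal elements, in linear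
coordinates `e`, parametrizes a set `S` of idempotents, provided that a point of the chart lies
in `S` exactly if its coordinate lies in `K`. -/
theorem isParam_graphChart {F : Type*} [NormedAddCommGroup F] [NormedSpace ℝ F]
    [FiniteDimensional ℝ F] [FiniteDimensional ℝ R] {q : R} (hq : q * q = q) {K : Submodule ℝ R}
    (hK : ∀ T ∈ K, q * T + T * q = T) {S : Set R} (hS : ∀ p ∈ S, p * p = p)
    (hKS : ∀ T, q * T + T * q = T → IsUnit (1 + T) → (graphChart q T ∈ S ↔ T ∈ K))
    (e : F ≃ₗ[ℝ] K) :
    IsParam S {u | IsUnit (1 + (e u : R))} (fun u => graphChart q (e u)) := by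
  obtain ⟨l, hl⟩ := LinearMap.exists_leftInverse_of_injective
    (K.subtype ∘ₗ (e : F →ₗ[ℝ] K)) (LinearMap.ker_eq_bot.2
      (K.injective_subtype.comp e.injective))
  have hl' (u : F) : l (e u : R) = u := congrArg (· u) hl
  let e' : F →L[ℝ] R := LinearMap.toContinuousLinearMap (K.subtype ∘ₗ (e : F →ₗ[ℝ] K))
  let l' : R →L[ℝ] F := LinearMap.toContinuousLinearMap l
  have he' : Continuous fun u : F => (e u : R) := e'.continuous
  have h1 : ContDiff ℝ ∞ (intertwiner q) := by unfold intertwiner; fun_prop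
  have h2 : ContDiff ℝ ∞ (diagIntertwiner q) := by unfold diagIntertwiner; fun_prop
  refine IsParam.of_smooth_inverse
    (O := {p | IsUnit (intertwiner q p)} ∩ {p | IsUnit (diagIntertwiner q p)})
    (φ := fun p => l' (graphChartInv q p)) (isOpen_isUnit_comp (by fun_prop)) ?_
    ((isOpen_isUnit_comp h1.continuous).inter (isOpen_isUnit_comp h2.continuous)) ?_ ?_ ?_ ?_ ?_
  · exact (contDiffOn_graphChart q).comp e'.contDiff.contDiffOn fun u hu => hu
  · exact (l'.contDiff.comp_contDiffOn (contDiffOn_graphChartInv q)).mono fun p hp => hp.2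
  · intro u hu
    exact (hKS _ (hK _ (e u).2) hu).2 (e u).2
  · intro u hu
    have h := intertwiner_graphChart hq (hK _ (e u).2) hu
    exact ⟨h.1, h.2.1⟩
  · intro u hu
    have h := intertwiner_graphChart hq (hK _ (e u).2) hu
    rw [h.2.2]
    exact hl' u
  · intro p hpS hp
    obtain ⟨h3, h4, h5⟩ := graphChart_graphChartInv hq (hS p hpS) hp.1 hp.2
    have h6 : graphChartInv q p ∈ K := (hKS _ h3 h4).1 (h5.symm ▸ hpS)
    have h7 : e (l' (graphChartInv q p)) = ⟨_, h6⟩ := by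
      have : l' (graphChartInv q p) = e.symm ⟨_, h6⟩ := by
        rw [← hl' (e.symm ⟨_, h6⟩)]
        simp [l']
      rw [this, e.apply_symm_apply]
    refine ⟨?_, ?_⟩
    · rw [Set.mem_ofPred_eq, h7]; exact h4
    · simp only [h7]; exact h5

theorem fderiv_graphChart_comp {F : Type*} [NormedAddCommGroup F] [NormedSpace ℝ F]
    [FiniteDimensional ℝ F] {q : R} {K : Submodule ℝ R} (e : F ≃ₗ[ℝ] K) {u : F}
    (hu : IsUnit (1 + (e u : R))) (v : F) :
    fderiv ℝ (fun u => graphChart q (e u)) u v =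
      (e v : R) * Ring.inverse (1 + (e u : R)) * graphChart q (e u) -
        graphChart q (e u) * ((e v : R) * Ring.inverse (1 + (e u : R))) := by
  let e' : F →L[ℝ] R := LinearMap.toContinuousLinearMap (K.subtype ∘ₗ (e : F →ₗ[ℝ] K))
  obtain ⟨D, hD, hDS⟩ := hasFDerivAt_graphChart q (e u : R) hu
  have h : HasFDerivAt (fun u => graphChart q (e u)) (D ∘L e') u :=
    HasFDerivAt.comp u (f := e') hD e'.hasFDerivAt
  rw [h.fderiv, ← hDS]
  rfl

/-- At its centre the differential of the graph chart is the commutator with `q`, so the commutators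
of `q` with coordinates of points of `S` are tangent to `S`. -/
theorem offDiag_mem_tangentSpace [FiniteDimensional ℝ R] {q : R} (hq : q * q = q)
    {K : Submodule ℝ R} (hK : ∀ T ∈ K, q * T + T * q = T) {S : Set R} (hS : ∀ p ∈ S, p * p = p)
    (hKS : ∀ T, q * T + T * q = T → IsUnit (1 + T) → (graphChart q T ∈ S ↔ T ∈ K))
    {T : R} (hT : T ∈ K) : T * q - q * T ∈ tangentSpace S q := by
  have h := isParam_graphChart hq hK hS hKS (LinearEquiv.refl ℝ K)
  have h0 : IsUnit (1 + ((LinearEquiv.refl ℝ K 0 : K) : R)) := by simp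
  have h1 := h.fderiv_mem h0 ⟨T, hT⟩
  rw [fderiv_graphChart_comp _ h0] at h1
  simpa using h1

end NormedRing

/-! ### Traces, idempotents and orthogonal projections -/

section Operators

variable {H : Type*} [NormedAddCommGroup H] [InnerProductSpace ℂ H]

section Trace

variable [FiniteDimensional ℂ H]

theorem finiteDimensional_real : FiniteDimensional ℝ (H →L[ℂ] H) :=
  FiniteDimensional.trans ℝ ℂ (H →L[ℂ] H)

theorem tr_mul_comm (A B : H →L[ℂ] H) : tr (A * B) = tr (B * A) :=
  LinearMap.trace_mul_comm ℂ (A : H →ₗ[ℂ] H) (B : H →ₗ[ℂ] H)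

theorem mem_idempotents {n : ℕ} {q : H →L[ℂ] H} :
    q ∈ idempotents H n ↔ q * q = q ∧ tr q = n := Iff.rfl

theorem finrank_range_of_mem {n : ℕ} {q : H →L[ℂ] H} (hq : q ∈ idempotents H n) :
    Module.finrank ℂ (LinearMap.range (q : H →ₗ[ℂ] H)) = n := by
  have h1 : IsIdempotentElem (q : H →ₗ[ℂ] H) :=
    congrArg (fun f : H →L[ℂ] H => (f : H →ₗ[ℂ] H)) hq.1
  have h2 := (LinearMap.IsIdempotentElem.isProj_range _ h1).trace
  rw [hq.2] at h2
  exact_mod_cast h2.symm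

theorem graphChart_mem_idempotents {n : ℕ} {q T : H →L[ℂ] H} (hq : q ∈ idempotents H n)
    (hu : IsUnit (1 + T)) : graphChart q T ∈ idempotents H n := by
  refine ⟨graphChart_mul_self hq.1 hu, ?_⟩
  rw [← tr_apply, graphChart, tr_mul_comm, ← mul_assoc, Ring.inverse_mul_cancel _ hu, one_mul]
  exact hq.2

/-- A product of three off-diagonal operators is off-diagonal, so it has trace zero. -/
theorem tr_mul_mul_offDiag {q A B C : H →L[ℂ] H} (hq : q * q = q) (hA : q * A + A * q = A)
    (hB : q * B + B * q = B) (hC : q * C + C * q = C) : tr (A * B * C) = 0 := by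
  have h0 := offDiag_mul_eq_zero hq hC
  have hc : q * (A * B) = A * B * q := offDiag_mul_commute hA hB
  have h1 : tr (A * B * (C * q)) = 0 := by
    have : A * B * (C * q) = A * B * (C * q) * q := by
      simp only [mul_assoc, hq]
    rw [this, tr_mul_comm, ← mul_assoc, hc, mul_assoc, ← mul_assoc q C q, h0, mul_zero, map_zero]
  have h2 : tr (A * B * (q * C)) = 0 := by
    rw [← mul_assoc, ← hc, mul_assoc, tr_mul_comm, mul_assoc, h1]
  rw [← hC, mul_add, map_add, h1, h2, add_zero]

theorem tr_mul_offDiag {q A : H →L[ℂ] H} (hq : q * q = q) (hA : q * A + A * q = A) :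
    tr (q * A) = 0 := by
  rw [← hq, mul_assoc, tr_mul_comm, offDiag_mul_eq_zero hq hA, map_zero]

/-- Against an off-diagonal operator, only the off-diagonal part of `B` contributes to the trace. -/
theorem tr_offDiag_mul {q A B : H →L[ℂ] H} (hq : q * q = q) (hA : q * A + A * q = A) :
    tr (A * (q * B * (1 - q) + (1 - q) * B * q)) = tr (A * B) := by
  have h1 := offDiag_mul_eq_zero hq hA
  have h2 := offDiag_compl_mul_eq_zero hA hq
  have h3 : tr (A * (q * B * (1 - q))) = tr ((1 - q) * A * q * B) := by
    rw [← mul_assoc, tr_mul_comm]; simp only [mul_assoc]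
  have h4 : tr (A * ((1 - q) * B * q)) = tr (q * A * (1 - q) * B) := by
    rw [← mul_assoc, tr_mul_comm]; simp only [mul_assoc]
  have h5 : A = (1 - q) * A * q + q * A * (1 - q) + (q * A * q + (1 - q) * A * (1 - q)) := by
    noncomm_ring
  rw [mul_add, map_add, h3, h4, ← map_add, ← add_mul]
  rw [h1, h2, add_zero, add_zero] at h5
  rw [← h5]

theorem proj_mul_self {q : H →L[ℂ] H} : proj q * q = q := by
  ext x
  exact Submodule.starProjection_eq_self_iff.2 ⟨x, rfl⟩

theorem self_mul_proj {q : H →L[ℂ] H} (hq : q * q = q) : q * proj q = proj q := by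
  ext x
  obtain ⟨y, hy⟩ : proj q x ∈ LinearMap.range (q : H →ₗ[ℂ] H) :=
    Submodule.starProjection_apply_mem _ _
  change q (proj q x) = proj q x
  rw [← hy]
  exact congrArg (fun f : H →L[ℂ] H => f y) hq

end Trace

section Star

/-- The chart centred at an orthogonal projection `p` transforms the adjoint into `T ↦ -T*`. -/
theorem star_graphChart [CompleteSpace H] {p T : H →L[ℂ] H} (hp : p * p = p) (hps : star p = p)
    (hT : p * T + T * p = T) (hu : IsUnit (1 + T)) :
    p * star T + star T * p = star T ∧ IsUnit (1 + -star T) ∧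
      star (graphChart p T) = graphChart p (-star T) := by
  have hTs : p * star T + star T * p = star T := by
    have := congrArg star hT
    simp only [star_add, star_mul, hps] at this
    rw [add_comm]; exact this
  have hTn : p * -star T + -star T * p = -star T := by
    rw [mul_neg, neg_mul, ← neg_add, hTs]
  have hus : IsUnit (1 + star T) := by simpa using hu.star
  have hun : IsUnit (1 + -star T) := by
    rw [← sub_eq_add_neg]; exact isUnit_one_sub_of_offDiag hp hTs hus
  refine ⟨hTs, hun, ?_⟩
  have h1 := one_sub_mul_graphChart hp hTn hun
  rw [sub_neg_eq_add] at h1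
  have h2 : graphChart p (-star T) = Ring.inverse (1 + star T) * (p * (1 + star T)) := by
    rw [← h1, ← mul_assoc, Ring.inverse_mul_cancel _ hus, one_mul]
  rw [h2, graphChart, star_mul, star_mul, hps, ← Ring.inverse_star]
  simp

variable [FiniteDimensional ℂ H] [CompleteSpace H]

theorem tr_star (A : H →L[ℂ] H) : tr (star A) = starRingEnd ℂ (tr A) := by
  rw [tr_apply, tr_apply, LinearMap.trace_eq_sum_inner _ (stdOrthonormalBasis ℂ H),
    LinearMap.trace_eq_sum_inner _ (stdOrthonormalBasis ℂ H), map_sum]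
  refine Finset.sum_congr rfl fun i _ => ?_
  rw [inner_conj_symm]
  exact ContinuousLinearMap.adjoint_inner_right _ _ _

/-- The trace form is positive definite. -/
theorem tr_star_mul_self_pos {A : H →L[ℂ] H} (hA : A ≠ 0) : 0 < (tr (star A * A)).re := by
  have h1 (x : H) : (inner ℂ x ((star A * A) x)).re = ‖A x‖ ^ 2 := by
    rw [mul_apply_eq_comp, ContinuousLinearMap.star_eq_adjoint,
      ContinuousLinearMap.adjoint_inner_right]
    exact inner_self_eq_norm_sq (𝕜 := ℂ) (A x)
  have h2 : (tr (star A * A)).re = ∑ i, ‖A (stdOrthonormalBasis ℂ H i)‖ ^ 2 := by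
    rw [tr_apply, LinearMap.trace_eq_sum_inner _ (stdOrthonormalBasis ℂ H), Complex.re_sum]
    exact Finset.sum_congr rfl fun i _ => h1 _
  rw [h2]
  obtain ⟨i, hi⟩ : ∃ i, A (stdOrthonormalBasis ℂ H i) ≠ 0 := by
    by_contra! h
    refine hA (ContinuousLinearMap.coe_injective ?_)
    refine (stdOrthonormalBasis ℂ H).toBasis.ext fun i => ?_
    simpa using h i
  exact Finset.sum_pos' (fun i _ => by positivity) ⟨i, Finset.mem_univ _, by positivity⟩

theorem eq_zero_of_tr_star_mul_self {A : H →L[ℂ] H} (h : (tr (star A * A)).re = 0) : A = 0 := by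
  by_contra hA
  exact (tr_star_mul_self_pos hA).ne' h

/-- The number `tr (p A A)` is the squared Hilbert–Schmidt norm of the block `A p`, which
determines a self-adjoint off-diagonal operator `A`. -/
theorem tr_sq_pos {p A : H →L[ℂ] H} (hp : p * p = p) (hps : star p = p)
    (hA : p * A + A * p = A) (hAs : star A = A) (h0 : A ≠ 0) : 0 < (tr (p * A * A)).re := by
  have h1 : A * p ≠ 0 := by
    intro h
    have h' : p * A = 0 := by rw [← star_eq_zero]; simpa [hps, hAs] using h
    exact h0 (by rw [← hA, h, h', add_zero])
  have h2 : tr (p * A * A) = tr (star (A * p) * (A * p)) := by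
    rw [star_mul, hps, hAs, tr_mul_comm _ (A * p), mul_assoc A p, ← mul_assoc p p, hp,
      tr_mul_comm A]
  rw [h2]
  exact tr_star_mul_self_pos h1

theorem mem_grassmannian_iff {n : ℕ} {p : H →L[ℂ] H} :
    p ∈ grassmannian H n ↔ p ∈ idempotents H n ∧ star p = p := by
  constructor
  · rintro ⟨V, hV, rfl⟩
    have h := isStarProjection_starProjection (U := V)
    refine ⟨⟨h.isIdempotentElem, ?_⟩, h.isSelfAdjoint⟩
    have h1 : IsIdempotentElem (V.starProjection : H →ₗ[ℂ] H) :=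
      congrArg (fun f : H →L[ℂ] H => (f : H →ₗ[ℂ] H)) h.isIdempotentElem
    rw [(LinearMap.IsIdempotentElem.isProj_range _ h1).trace, Submodule.range_starProjection, hV]
  · rintro ⟨h1, h2⟩
    obtain ⟨K, _, rfl⟩ := isStarProjection_iff_eq_starProjection.1 ⟨h1.1, h2⟩
    refine ⟨K, ?_, rfl⟩
    rw [← finrank_range_of_mem h1, Submodule.range_starProjection]

theorem star_proj (q : H →L[ℂ] H) : star (proj q) = proj q :=
  (isStarProjection_starProjection (U := LinearMap.range (q : H →ₗ[ℂ] H))).isSelfAdjoint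

theorem proj_eq_iff {q p : H →L[ℂ] H} (hq : q * q = q) (hps : star p = p) :
    proj q = p ↔ p * q = q ∧ q * p = p := by
  constructor
  · rintro rfl
    exact ⟨proj_mul_self, self_mul_proj hq⟩
  · rintro ⟨h1, h2⟩
    have h3 : p * proj q = proj q := by rw [← self_mul_proj hq, ← mul_assoc, h1]
    have h4 : proj q * p = p := by rw [← h2, ← mul_assoc, proj_mul_self]
    have h5 := congrArg star h4
    rw [star_mul, hps, star_proj, h3] at h5
    exact h5

theorem proj_eq_self {n : ℕ} {p : H →L[ℂ] H} (hp : p ∈ grassmannian H n) : proj p = p := by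
  obtain ⟨h1, h2⟩ := mem_grassmannian_iff.1 hp
  exact (proj_eq_iff h1.1 h2).2 ⟨h1.1, h1.1⟩

theorem graphChart_mem_grassmannian_iff {n : ℕ} {p T : H →L[ℂ] H} (hp : p ∈ grassmannian H n)
    (hT : p * T + T * p = T) (hu : IsUnit (1 + T)) :
    graphChart p T ∈ grassmannian H n ↔ star T = -T := by
  obtain ⟨h1, h2⟩ := mem_grassmannian_iff.1 hp
  obtain ⟨h3, h4, h5⟩ := star_graphChart h1.1 h2 hT hu
  rw [mem_grassmannian_iff, and_iff_right (graphChart_mem_idempotents h1 hu), h5]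
  constructor
  · intro h
    have h6 := congrArg (graphChartInv p) h
    rw [(intertwiner_graphChart h1.1 hT hu).2.2,
      (intertwiner_graphChart h1.1 (by rw [mul_neg, neg_mul, ← neg_add, h3]) h4).2.2] at h6
    exact neg_eq_iff_eq_neg.1 h6
  · intro h
    rw [h, neg_neg]

end Star

/-! ### Spaces of off-diagonal operators and their dimensions -/

section Dimension

/-- The operators that are off-diagonal with respect to `q`. -/
def offDiag (q : H →L[ℂ] H) : Submodule ℝ (H →L[ℂ] H) where
  carrier := {A | q * A + A * q = A}
  add_mem' {A B} (hA : _ = _) (hB : _ = _) := by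
    change _ = _
    rw [mul_add, add_mul, add_add_add_comm, hA, hB]
  zero_mem' := by change _ = _; simp
  smul_mem' r A (hA : _ = _) := by
    change _ = _
    rw [mul_smul_comm, smul_mul_assoc, ← smul_add, hA]

theorem mem_offDiag {q A : H →L[ℂ] H} : A ∈ offDiag q ↔ q * A + A * q = A := Iff.rfl

/-- The operators that vanish on the kernel of `q` and map into the kernel of `q`. -/
def lowerBlock (q : H →L[ℂ] H) : Submodule ℂ (H →L[ℂ] H) where
  carrier := {A | A * q = A ∧ q * A = 0}
  add_mem' {A B} hA hB := ⟨by rw [add_mul, hA.1, hB.1], by rw [mul_add, hA.2, hB.2, add_zero]⟩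
  zero_mem' := by simp
  smul_mem' r A hA := ⟨by rw [smul_mul_assoc, hA.1], by rw [mul_smul_comm, hA.2, smul_zero]⟩

theorem mem_lowerBlock {q A : H →L[ℂ] H} : A ∈ lowerBlock q ↔ A * q = A ∧ q * A = 0 := Iff.rfl

/-- Operators in the lower block are the linear maps from the image to the kernel. -/
def lowerBlockEquiv [FiniteDimensional ℂ H] {q : H →L[ℂ] H} (hq : q * q = q) :
    lowerBlock q ≃ₗ[ℂ]
      (LinearMap.range (q : H →ₗ[ℂ] H) →ₗ[ℂ] LinearMap.ker (q : H →ₗ[ℂ] H)) where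
  toFun A := LinearMap.codRestrict _ (((A : H →L[ℂ] H) : H →ₗ[ℂ] H) ∘ₗ Submodule.subtype _)
    fun x => congrArg (fun f : H →L[ℂ] H => f x) A.2.2
  map_add' A B := rfl
  map_smul' r A := rfl
  invFun f := ⟨LinearMap.toContinuousLinearMap
      (Submodule.subtype _ ∘ₗ f ∘ₗ LinearMap.rangeRestrict (q : H →ₗ[ℂ] H)), by
    constructor
    · ext x
      have : LinearMap.rangeRestrict (q : H →ₗ[ℂ] H) (q x) =
          LinearMap.rangeRestrict (q : H →ₗ[ℂ] H) x :=
        Subtype.ext (congrArg (fun f : H →L[ℂ] H => f x) hq)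
      change ((f (LinearMap.rangeRestrict (q : H →ₗ[ℂ] H) (q x)) : H)) = _
      rw [this]; rfl
    · ext x
      exact (f (LinearMap.rangeRestrict (q : H →ₗ[ℂ] H) x)).2⟩
  left_inv A := by
    ext x
    exact congrArg (fun f : H →L[ℂ] H => f x) A.2.1
  right_inv f := by
    ext ⟨_, y, rfl⟩
    have : LinearMap.rangeRestrict (q : H →ₗ[ℂ] H) (q y) = ⟨q y, y, rfl⟩ :=
        Subtype.ext (congrArg (fun f : H →L[ℂ] H => f y) hq)
    change ((f (LinearMap.rangeRestrict (q : H →ₗ[ℂ] H) (q y)) : H)) = _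
    rw [this]; rfl

theorem finrank_lowerBlock [FiniteDimensional ℂ H] {n : ℕ} {q : H →L[ℂ] H}
    (hq : q ∈ idempotents H n) :
    Module.finrank ℂ (lowerBlock q) = n * (Module.finrank ℂ H - n) := by
  have h := LinearMap.finrank_range_add_finrank_ker (q : H →ₗ[ℂ] H)
  rw [finrank_range_of_mem hq] at h
  rw [(lowerBlockEquiv hq.1).finrank_eq, Module.finrank_linearMap, finrank_range_of_mem hq, ← h,
    Nat.add_sub_cancel_left]

theorem one_sub_mem_idempotents [FiniteDimensional ℂ H] {n : ℕ} {q : H →L[ℂ] H}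
    (hq : q ∈ idempotents H n) :
    n ≤ Module.finrank ℂ H ∧ 1 - q ∈ idempotents H (Module.finrank ℂ H - n) := by
  have h := LinearMap.finrank_range_add_finrank_ker (q : H →ₗ[ℂ] H)
  rw [finrank_range_of_mem hq] at h
  have hn : n ≤ Module.finrank ℂ H := by omega
  refine ⟨hn, ?_, ?_⟩
  · have : (1 - q) * (1 - q) = 1 - q + (q * q - q) := by noncomm_ring
    rw [this, hq.1, sub_self, add_zero]
  · rw [← tr_apply, map_sub, (mem_idempotents.1 hq).2, Nat.cast_sub hn]
    congr 1
    exact LinearMap.trace_one ℂ H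

/-- An off-diagonal operator consists of its lower and its upper block. -/
def offDiagEquiv {q : H →L[ℂ] H} (hq : q * q = q) :
    offDiag q ≃ₗ[ℝ] lowerBlock q × lowerBlock (1 - q) where
  toFun A := (⟨A * q, by
      have h := offDiag_mul_eq_zero hq A.2
      exact ⟨by rw [mul_assoc, hq], by rw [← mul_assoc, h]⟩⟩,
    ⟨q * A, by
      have h := offDiag_mul_eq_zero hq A.2
      exact ⟨by rw [mul_sub, h, mul_one, sub_zero],
        by rw [sub_mul, one_mul, ← mul_assoc, hq, sub_self]⟩⟩)
  map_add' A B := Prod.ext (Subtype.ext (add_mul _ _ _)) (Subtype.ext (mul_add _ _ _))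
  map_smul' r A := Prod.ext (Subtype.ext (smul_mul_assoc _ _ _))
    (Subtype.ext (mul_smul_comm _ _ _))
  invFun a := ⟨a.1 + a.2, by
    obtain ⟨⟨a, ha1, ha2⟩, ⟨b, hb1, hb2⟩⟩ := a
    have hb3 : b * q = 0 := by rw [mul_sub, mul_one] at hb1; simpa using hb1
    have hb4 : q * b = b := by rw [sub_mul, one_mul, sub_eq_zero] at hb2; exact hb2.symm
    rw [mem_offDiag]
    simp only [mul_add, add_mul, ha1, ha2, hb3, hb4]
    abel⟩
  left_inv A := Subtype.ext (by
    change (A : H →L[ℂ] H) * q + q * A = A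
    rw [add_comm]; exact A.2)
  right_inv a := by
    obtain ⟨⟨a, ha1, ha2⟩, ⟨b, hb1, hb2⟩⟩ := a
    have hb3 : b * q = 0 := by rw [mul_sub, mul_one] at hb1; simpa using hb1
    have hb4 : q * b = b := by rw [sub_mul, one_mul, sub_eq_zero] at hb2; exact hb2.symm
    refine Prod.ext (Subtype.ext ?_) (Subtype.ext ?_)
    · change (a + b) * q = a
      rw [add_mul, ha1, hb3, add_zero]
    · change q * (a + b) = b
      rw [mul_add, ha2, hb4, zero_add]

theorem finrank_offDiag [FiniteDimensional ℂ H] {n : ℕ} {q : H →L[ℂ] H}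
    (hq : q ∈ idempotents H n) :
    Module.finrank ℝ (offDiag q) = 4 * (n * (Module.finrank ℂ H - n)) := by
  obtain ⟨h1, h2⟩ := one_sub_mem_idempotents hq
  have : FiniteDimensional ℝ (lowerBlock q) := FiniteDimensional.trans ℝ ℂ _
  have : FiniteDimensional ℝ (lowerBlock (1 - q)) := FiniteDimensional.trans ℝ ℂ _
  rw [(offDiagEquiv hq.1).finrank_eq, Module.finrank_prod, finrank_real_of_complex,
    finrank_real_of_complex, finrank_lowerBlock hq, finrank_lowerBlock h2, Nat.sub_sub_self h1,
    mul_comm _ n]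
  ring

/-- The off-diagonal skew-adjoint operators. -/
def skewOffDiag [CompleteSpace H] (p : H →L[ℂ] H) : Submodule ℝ (H →L[ℂ] H) where
  carrier := {A | A ∈ offDiag p ∧ star A = -A}
  add_mem' {A B} hA hB := ⟨add_mem hA.1 hB.1, by rw [star_add, hA.2, hB.2, neg_add]⟩
  zero_mem' := ⟨zero_mem _, by simp⟩
  smul_mem' r A hA := ⟨Submodule.smul_mem _ r hA.1, by rw [star_smul, hA.2]; simp⟩

theorem mem_skewOffDiag [CompleteSpace H] {p A : H →L[ℂ] H} :
    A ∈ skewOffDiag p ↔ p * A + A * p = A ∧ star A = -A := Iff.rfl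

/-- A skew-adjoint off-diagonal operator is determined by its lower block, which is arbitrary. -/
def skewOffDiagEquiv [CompleteSpace H] {p : H →L[ℂ] H} (hp : p * p = p) (hps : star p = p) :
    skewOffDiag p ≃ₗ[ℝ] lowerBlock p where
  toFun A := ⟨A * p, by
      have h := offDiag_mul_eq_zero hp A.2.1
      exact ⟨by rw [mul_assoc, hp], by rw [← mul_assoc, h]⟩⟩
  map_add' A B := Subtype.ext (add_mul _ _ _)
  map_smul' r A := Subtype.ext (smul_mul_assoc _ _ _)
  invFun a := ⟨a - star (a : H →L[ℂ] H), by
    obtain ⟨a, ha1, ha2⟩ := a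
    have h1 := congrArg star ha1
    have h2 := congrArg star ha2
    rw [star_mul, hps] at h1 h2
    rw [star_zero] at h2
    refine mem_skewOffDiag.2 ⟨?_, by simp⟩
    simp only [mul_sub, sub_mul, ha1, ha2, h1, h2]
    abel⟩
  left_inv A := Subtype.ext (by
    obtain ⟨A, hA, hAs⟩ := A
    change A * p - star (A * p) = A
    rw [star_mul, hps, hAs, mul_neg, sub_neg_eq_add, add_comm]
    exact hA)
  right_inv a := by
    obtain ⟨a, ha1, ha2⟩ := a
    have h2 := congrArg star ha2
    rw [star_mul, hps, star_zero] at h2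
    refine Subtype.ext ?_
    change (a - star a) * p = a
    rw [sub_mul, h2, ha1, sub_zero]

theorem finrank_skewOffDiag [FiniteDimensional ℂ H] [CompleteSpace H] {n : ℕ} {p : H →L[ℂ] H}
    (hp : p ∈ grassmannian H n) :
    Module.finrank ℝ (skewOffDiag p) = 2 * (n * (Module.finrank ℂ H - n)) := by
  obtain ⟨h1, h2⟩ := mem_grassmannian_iff.1 hp
  rw [(skewOffDiagEquiv h1.1 h2).finrank_eq, finrank_real_of_complex, finrank_lowerBlock h1]

end Dimension

end Operators

/-! ### Algebra of the complex structures and of the symplectic form -/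

section Manifolds

variable {H : Type*} [NormedAddCommGroup H] [InnerProductSpace ℂ H]

/-- The commutator with an idempotent is an involution on off-diagonal operators. -/
theorem offDiag_commutator {R : Type*} [Ring R] {q A : R} (hq : q * q = q)
    (hA : q * A + A * q = A) :
    q * (A * q - q * A) + (A * q - q * A) * q = A * q - q * A ∧
      (A * q - q * A) * q - q * (A * q - q * A) = A := by
  have h0 := offDiag_mul_eq_zero hq hA
  constructor
  · have : q * (A * q - q * A) + (A * q - q * A) * q = A * (q * q) - q * q * A := by noncomm_ring
    rw [this, hq]
  · have : (A * q - q * A) * q - q * (A * q - q * A) =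
        q * q * A + A * (q * q) - 2 * (q * A * q) := by noncomm_ring
    rw [this, hq, h0, hA]; simp

theorem complexI_apply (q A : H →L[ℂ] H) : complexI q A = Complex.I • A := rfl

theorem complexI_complexI (q A : H →L[ℂ] H) : complexI q (complexI q A) = -A := by
  simp [complexI_apply, smul_smul]

theorem contDiffOn_complexI {F : Type*} [NormedAddCommGroup F] [NormedSpace ℝ F]
    {S : Set (H →L[ℂ] H)} {U : Set F} {ψ : F → H →L[ℂ] H} (h : IsParam S U ψ) (v : F) :
    ContDiffOn ℝ ∞ (fun u => complexI (ψ u) (fderiv ℝ ψ u v)) U :=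
  (complexI (0 : H →L[ℂ] H)).contDiff.comp_contDiffOn (h.contDiffOn_fderiv_apply v)

theorem complexI_mem_offDiag {q A : H →L[ℂ] H} (hA : A ∈ offDiag q) :
    complexI q A ∈ offDiag q := by
  rw [mem_offDiag, complexI_apply, mul_smul_comm, smul_mul_assoc, ← smul_add, hA]

variable [FiniteDimensional ℂ H]

theorem complexJ_apply (q A : H →L[ℂ] H) : complexJ q A = Complex.I • (A * q - q * A) := rfl

theorem complexI_complexJ (q A : H →L[ℂ] H) :
    complexI q (complexJ q A) = complexJ q (complexI q A) := by
  simp only [complexI_apply, complexJ_apply, smul_mul_assoc, mul_smul_comm, ← smul_sub]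

theorem complexJ_mem_offDiag {q A : H →L[ℂ] H} (hq : q * q = q) (hA : A ∈ offDiag q) :
    complexJ q A ∈ offDiag q := by
  rw [mem_offDiag, complexJ_apply, mul_smul_comm, smul_mul_assoc, ← smul_add,
    (offDiag_commutator hq hA).1]

theorem complexJ_complexJ {q A : H →L[ℂ] H} (hq : q * q = q) (hA : A ∈ offDiag q) :
    complexJ q (complexJ q A) = -A := by
  rw [complexJ_apply, complexJ_apply, smul_mul_assoc, mul_smul_comm, ← smul_sub,
    (offDiag_commutator hq hA).2, smul_smul]
  simp

/-- The differential of the graph chart intertwines the values of `J` at the centre of the chart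
and at the point. -/
theorem complexJ_graphChart {q T A : H →L[ℂ] H} (hq : q * q = q) (hT : T ∈ offDiag q)
    (hA : A ∈ offDiag q) (hu : IsUnit (1 + T)) :
    complexJ (graphChart q T) (A * Ring.inverse (1 + T) * graphChart q T -
      graphChart q T * (A * Ring.inverse (1 + T))) =
      complexJ q A * Ring.inverse (1 + T) * graphChart q T -
        graphChart q T * (complexJ q A * Ring.inverse (1 + T)) := by
  have h := graphChart_commutator hq hT hA hu (D := fun A => A * Ring.inverse (1 + T) *
    graphChart q T - graphChart q T * (A * Ring.inverse (1 + T))) (fun _ => rfl)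
  rw [complexJ_apply, h, complexJ_apply]
  simp only [smul_mul_assoc, mul_smul_comm, ← smul_sub]

theorem reOmega_apply (c : ℝ) (q A B : H →L[ℂ] H) :
    reOmega c q ![A, B] = -(c * (tr (q * (A * B - B * A))).im) := by
  change (Omega c q ![A, B]).re = _
  rw [Omega_apply]; simp

theorem imOmega_apply (c : ℝ) (q A B : H →L[ℂ] H) :
    imOmega c q ![A, B] = c * (tr (q * (A * B - B * A))).re := by
  change (Omega c q ![A, B]).im = _
  rw [Omega_apply]; simp

/-- Pointwise reason for the invariance of `Ω` under `J`. -/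
theorem mul_complexJ_mul_complexJ {q A B : H →L[ℂ] H} (hq : q * q = q)
    (hA : q * A + A * q = A) (hB : q * B + B * q = B) :
    q * (complexJ q A * complexJ q B) = q * (A * B) := by
  have hA0 := offDiag_mul_eq_zero hq hA
  have hc : q * (A * B) = A * B * q := offDiag_mul_commute hA hB
  rw [complexJ_apply, complexJ_apply, smul_mul_smul_comm, Complex.I_mul_I, neg_one_smul, mul_neg]
  have : q * ((A * q - q * A) * (B * q - q * B)) =
      q * A * q * (B * q - q * B) - q * q * (A * B) * q + q * q * A * q * B := by noncomm_ring
  rw [this, hq, hA0, hc, mul_assoc, hq]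
  simp

theorem Omega_complexJ {c : ℝ} {q A B : H →L[ℂ] H} (hq : q * q = q)
    (hA : q * A + A * q = A) (hB : q * B + B * q = B) :
    Omega c q ![complexJ q A, complexJ q B] = Omega c q ![A, B] := by
  rw [Omega_apply, Omega_apply, mul_sub, mul_sub, mul_complexJ_mul_complexJ hq hA hB,
    mul_complexJ_mul_complexJ hq hB hA]

/-- The value of `Ω (J A, A)` up to the factor `i c`, which is the Kähler metric on the Grassmannian
and gives the Lagrangian condition for `Im Ω`. -/
theorem tr_commutator_complexJ {q A : H →L[ℂ] H} (hq : q * q = q) (hA : q * A + A * q = A) :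
    tr (q * (complexJ q A * A - A * complexJ q A)) = -(2 * Complex.I * tr (q * A * A)) := by
  have hA0 := offDiag_mul_eq_zero hq hA
  have hc : q * (A * A) = A * A * q := offDiag_mul_commute hA hA
  have h1 : q * ((A * q - q * A) * A - A * (A * q - q * A)) =
      q * A * q * A - q * q * (A * A) - q * (A * A) * q + q * A * q * A := by noncomm_ring
  have h2 : q * ((A * q - q * A) * A - A * (A * q - q * A)) = -2 * (q * A * A) := by
    rw [h1, hq, hA0, hc, mul_assoc _ q q, hq, ← hc]; noncomm_ring
  rw [complexJ_apply, smul_mul_assoc, mul_smul_comm, ← smul_sub, mul_smul_comm, h2]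
  rw [map_smul, neg_mul, two_mul, map_neg, map_add, smul_eq_mul]
  ring

theorem graphChart_mem_idempotents_iff {n : ℕ} {q : H →L[ℂ] H} (hq : q ∈ idempotents H n) (T)
    (hT : q * T + T * q = T) (hu : IsUnit (1 + T)) :
    graphChart q T ∈ idempotents H n ↔ T ∈ offDiag q :=
  iff_of_true (graphChart_mem_idempotents hq hu) hT

/-! ### The manifolds of idempotents and of orthogonal projections -/

variable [CompleteSpace H]

theorem graphChart_mem_grassmannian_iff_mem {n : ℕ} {p : H →L[ℂ] H} (hp : p ∈ grassmannian H n)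
    (T) (hT : p * T + T * p = T) (hu : IsUnit (1 + T)) :
    graphChart p T ∈ grassmannian H n ↔ T ∈ skewOffDiag p := by
  rw [graphChart_mem_grassmannian_iff hp hT hu, mem_skewOffDiag, and_iff_right hT]

theorem mul_self_of_mem_grassmannian {n : ℕ} {p : H →L[ℂ] H} (hp : p ∈ grassmannian H n) :
    p * p = p := (mem_grassmannian_iff.1 hp).1.1

theorem isSubmanifold_idempotents (n : ℕ) :
    IsSubmanifold (4 * (n * (Module.finrank ℂ H - n))) (idempotents H n) := by
  intro q hq
  have := finiteDimensional_real (H := H)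
  let e : EuclideanSpace ℝ (Fin (4 * (n * (Module.finrank ℂ H - n)))) ≃ₗ[ℝ] offDiag q :=
    LinearEquiv.ofFinrankEq _ _ (by rw [finrank_offDiag hq, finrank_euclideanSpace_fin])
  exact ⟨_, _, isParam_graphChart hq.1 (fun T hT => hT) (fun p hp => hp.1)
    (graphChart_mem_idempotents_iff hq) e, 0, by simp, by simp⟩

theorem isSubmanifold_grassmannian (n : ℕ) :
    IsSubmanifold (2 * (n * (Module.finrank ℂ H - n))) (grassmannian H n) := by
  intro p hp
  have := finiteDimensional_real (H := H)
  let e : EuclideanSpace ℝ (Fin (2 * (n * (Module.finrank ℂ H - n)))) ≃ₗ[ℝ] skewOffDiag p :=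
    LinearEquiv.ofFinrankEq _ _ (by rw [finrank_skewOffDiag hp, finrank_euclideanSpace_fin])
  exact ⟨_, _, isParam_graphChart (mul_self_of_mem_grassmannian hp)
    (K := skewOffDiag p) (fun T hT => hT.1)
    (fun p hp => mul_self_of_mem_grassmannian hp)
    (graphChart_mem_grassmannian_iff_mem hp) e, 0, by simp, by simp⟩

theorem mem_tangentSpace_idempotents {n : ℕ} {q : H →L[ℂ] H} (hq : q ∈ idempotents H n)
    {A : H →L[ℂ] H} : A ∈ tangentSpace (idempotents H n) q ↔ q * A + A * q = A := by
  refine ⟨offDiag_of_mem_tangentSpace fun p hp => hp.1, fun hA => ?_⟩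
  have := finiteDimensional_real (H := H)
  obtain ⟨h1, h2⟩ := offDiag_commutator hq.1 hA
  have h := offDiag_mem_tangentSpace hq.1 (K := offDiag q) (fun T hT => hT) (fun p hp => hp.1)
    (graphChart_mem_idempotents_iff hq) h1
  rwa [h2] at h

theorem mem_tangentSpace_grassmannian {n : ℕ} {p : H →L[ℂ] H} (hp : p ∈ grassmannian H n)
    {A : H →L[ℂ] H} :
    A ∈ tangentSpace (grassmannian H n) p ↔ p * A + A * p = A ∧ star A = A := by
  have := finiteDimensional_real (H := H)
  have hpp := mul_self_of_mem_grassmannian hp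
  have hps := (mem_grassmannian_iff.1 hp).2
  constructor
  · intro hA
    refine ⟨offDiag_of_mem_tangentSpace (fun p hp => mul_self_of_mem_grassmannian hp) hA, ?_⟩
    refine Submodule.span_induction ?_ (by simp) ?_ ?_ hA
    · rintro v ⟨γ, hγ, hγS, rfl, hv⟩
      have h2 : (fun t => star (γ t)) =ᶠ[𝓝 0] γ := by
        filter_upwards [hγS] with t ht using (mem_grassmannian_iff.1 ht).2
      exact hv.star.unique (hv.congr_of_eventuallyEq h2)
    · intro A B _ _ hA hB
      rw [star_add, hA, hB]
    · intro r A _ hA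
      rw [star_smul, hA]; simp
  · rintro ⟨hA, hAs⟩
    obtain ⟨h1, h2⟩ := offDiag_commutator hpp hA
    have h := offDiag_mem_tangentSpace hpp (K := skewOffDiag p) (fun T hT => hT.1)
      (fun p hp => mul_self_of_mem_grassmannian hp) (graphChart_mem_grassmannian_iff_mem hp)
      (T := A * p - p * A) ⟨h1, by simp [hps, hAs]⟩
    rwa [h2] at h

theorem grassmannian_subset (n : ℕ) : grassmannian H n ⊆ idempotents H n :=
  fun _ hp => (mem_grassmannian_iff.1 hp).1

/-! ### The complex structures -/

theorem star_complexJ {p A : H →L[ℂ] H} (hps : star p = p) :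
    star (complexJ p A) = complexJ p (star A) := by
  rw [complexJ_apply, complexJ_apply, star_smul, star_sub, star_mul, star_mul, hps]
  simp only [RCLike.star_def, Complex.conj_I, neg_smul]
  rw [← smul_neg, neg_sub]

theorem contDiffOn_complexJ {F : Type*} [NormedAddCommGroup F] [NormedSpace ℝ F]
    {S : Set (H →L[ℂ] H)} {U : Set F} {ψ : F → H →L[ℂ] H} (h : IsParam S U ψ) (v : F) :
    ContDiffOn ℝ ∞ (fun u => complexJ (ψ u) (fderiv ℝ ψ u v)) U :=
  (complexI (0 : H →L[ℂ] H)).contDiff.comp_contDiffOn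
    (((h.contDiffOn_fderiv_apply v).mul h.contDiffOn).sub
      (h.contDiffOn.mul (h.contDiffOn_fderiv_apply v)))

theorem isAlmostComplex_complexI (n : ℕ) : IsAlmostComplex (idempotents H n) complexI where
  mem q hq A hA := by
    rw [mem_tangentSpace_idempotents hq] at hA ⊢
    exact complexI_mem_offDiag hA
  sq _ _ _ _ := complexI_complexI _ _
  smooth _ _ _ h v := contDiffOn_complexI h v

theorem isAlmostComplex_complexJ (n : ℕ) : IsAlmostComplex (idempotents H n) complexJ where
  mem q hq A hA := by
    rw [mem_tangentSpace_idempotents hq] at hA ⊢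
    exact complexJ_mem_offDiag hq.1 hA
  sq q hq A hA := complexJ_complexJ hq.1 ((mem_tangentSpace_idempotents hq).1 hA)
  smooth _ _ _ h v := contDiffOn_complexJ h v

theorem isAlmostComplex_complexJ_grassmannian (n : ℕ) :
    IsAlmostComplex (grassmannian H n) complexJ where
  mem p hp A hA := by
    rw [mem_tangentSpace_grassmannian hp] at hA ⊢
    refine ⟨complexJ_mem_offDiag (mul_self_of_mem_grassmannian hp) hA.1, ?_⟩
    rw [star_complexJ (mem_grassmannian_iff.1 hp).2, hA.2]
  sq p hp A hA := complexJ_complexJ (mul_self_of_mem_grassmannian hp)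
    ((mem_tangentSpace_grassmannian hp).1 hA).1
  smooth _ _ _ h v := contDiffOn_complexJ h v

/-- If the differential of the graph chart carries a constant complex structure `j` on the
coordinate space to the almost complex structure `𝒥`, then the chart is `𝒥`-holomorphic in
complex linear coordinates. -/
theorem exists_isHolParam {q : H →L[ℂ] H} (hq : q * q = q) {K : Submodule ℝ (H →L[ℂ] H)}
    (hK : ∀ T ∈ K, q * T + T * q = T) {S : Set (H →L[ℂ] H)} (hS : ∀ p ∈ S, p * p = p)
    (hKS : ∀ T, q * T + T * q = T → IsUnit (1 + T) → (graphChart q T ∈ S ↔ T ∈ K))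
    (𝒥 : (H →L[ℂ] H) → (H →L[ℂ] H) →L[ℝ] (H →L[ℂ] H)) (j : (H →L[ℂ] H) →L[ℝ] (H →L[ℂ] H))
    (hjK : ∀ T ∈ K, j T ∈ K) (hj : ∀ T ∈ K, j (j T) = -T)
    (h𝒥 : ∀ T ∈ K, IsUnit (1 + T) → ∀ A ∈ K, 𝒥 (graphChart q T)
      (A * Ring.inverse (1 + T) * graphChart q T - graphChart q T * (A * Ring.inverse (1 + T))) =
      j A * Ring.inverse (1 + T) * graphChart q T -
        graphChart q T * (j A * Ring.inverse (1 + T))) :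
    ∃ (m : ℕ) (U : Set (EuclideanSpace ℂ (Fin m))) (ψ : EuclideanSpace ℂ (Fin m) → H →L[ℂ] H),
      IsHolParam S 𝒥 U ψ ∧ q ∈ ψ '' U := by
  have := finiteDimensional_real (H := H)
  obtain ⟨m, e, he⟩ := exists_linearEquiv_intertwining
    ((j : (H →L[ℂ] H) →ₗ[ℝ] (H →L[ℂ] H)).restrict hjK)
    (fun T => Subtype.ext (hj T T.2))
  refine ⟨m, _, _, ⟨isParam_graphChart hq hK hS hKS e, fun u hu v => ?_⟩, 0, by simp, by simp⟩
  rw [fderiv_graphChart_comp e hu, fderiv_graphChart_comp e hu, h𝒥 _ (e u).2 hu _ (e v).2, he]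
  rfl

theorem isIntegrable_complexI (n : ℕ) : IsIntegrable (idempotents H n) complexI := by
  intro q hq
  refine exists_isHolParam hq.1 (K := offDiag q) (fun T hT => hT) (fun p hp => hp.1)
    (graphChart_mem_idempotents_iff hq) _ (complexI q) (fun T hT => complexI_mem_offDiag hT)
    (fun T _ => complexI_complexI q T) fun T _ _ A _ => ?_
  simp only [complexI_apply, smul_mul_assoc, mul_smul_comm, ← smul_sub]

theorem isIntegrable_complexJ (n : ℕ) : IsIntegrable (idempotents H n) complexJ := by
  intro q hq
  exact exists_isHolParam hq.1 (K := offDiag q) (fun T hT => hT) (fun p hp => hp.1)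
    (graphChart_mem_idempotents_iff hq) _ (complexJ q) (fun T hT => complexJ_mem_offDiag hq.1 hT)
    (fun T hT => complexJ_complexJ hq.1 hT) fun T hT hu A hA => complexJ_graphChart hq.1 hT hA hu

theorem isIntegrable_complexJ_grassmannian (n : ℕ) :
    IsIntegrable (grassmannian H n) complexJ := by
  intro p hp
  have hpp := mul_self_of_mem_grassmannian hp
  have hps := (mem_grassmannian_iff.1 hp).2
  refine exists_isHolParam hpp (K := skewOffDiag p) (fun T hT => hT.1)
    (fun p hp => mul_self_of_mem_grassmannian hp)
    (graphChart_mem_grassmannian_iff_mem hp) _ (complexJ p)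
    (fun T hT => ⟨complexJ_mem_offDiag hpp hT.1, ?_⟩)
    (fun T hT => complexJ_complexJ hpp hT.1)
    fun T hT hu A hA => complexJ_graphChart hpp hT.1 hA.1 hu
  rw [star_complexJ hps, hT.2, map_neg]

/-! ### The symplectic form -/

theorem reOmega_complexJ_pos {c : ℝ} (hc : 0 < c) {p A : H →L[ℂ] H} (hp : p * p = p)
    (hps : star p = p) (hA : p * A + A * p = A) (hAs : star A = A) (h0 : A ≠ 0) :
    0 < reOmega c p ![complexJ p A, A] := by
  have h := tr_sq_pos hp hps hA hAs h0
  rw [reOmega_apply, tr_commutator_complexJ hp hA]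
  simp
  positivity

/-- The form `Ω`, followed by a real-linear map, pulls back to smooth forms. -/
theorem contDiffOn_pullback_Omega {F W : Type*} [NormedAddCommGroup F] [NormedSpace ℝ F]
    [FiniteDimensional ℝ F] [NormedAddCommGroup W] [NormedSpace ℝ W] [FiniteDimensional ℝ W]
    (c : ℝ) (l : ℂ →L[ℝ] W) {U : Set F} (hU : IsOpen U) {ψ : F → H →L[ℂ] H}
    (h : ContDiffOn ℝ ∞ ψ U) :
    ContDiffOn ℝ ∞ (pullback ψ fun q => l.compContinuousAlternatingMap (Omega c q)) U := by
  refine contDiffOn_alternating_of_apply fun v w => ?_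
  have hd (v : F) : ContDiffOn ℝ ∞ (fun u => fderiv ℝ ψ u v) U :=
    (h.fderiv_of_isOpen hU (by simp)).clm_apply contDiffOn_const
  have h1 := h.mul (((hd v).mul (hd w)).sub ((hd w).mul (hd v)))
  have h2 := (tr.restrictScalars ℝ).contDiff.comp_contDiffOn h1
  exact l.contDiff.comp_contDiffOn (contDiffOn_const.mul (contDiffOn_const.mul h2))

/-- The exterior derivative of `Ω` on `B(H)` is the alternating form
`(A, B, C) ↦ 3 i Tr(A [B, C])`. It does not vanish in general, but its restriction to off-diagonal
operators does. -/
theorem extDeriv_Omega {W : Type*} [NormedAddCommGroup W] [NormedSpace ℝ W]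
    [FiniteDimensional ℝ W] (c : ℝ) (l : ℂ →L[ℝ] W) {q : H →L[ℂ] H} (hq : q * q = q)
    (v : Fin 3 → H →L[ℂ] H) (hv : ∀ i, q * v i + v i * q = v i) :
    DifferentiableAt ℝ (fun q : H →L[ℂ] H => l.compContinuousAlternatingMap (Omega c q)) q ∧
    extDeriv (fun q : H →L[ℂ] H => l.compContinuousAlternatingMap (Omega c q)) q v = 0 := by
  have := finiteDimensional_real (H := H)
  have hd : DifferentiableAt ℝ
      (fun q : H →L[ℂ] H => l.compContinuousAlternatingMap (Omega c q)) q := by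
    have h1 : ContDiffOn ℝ ∞
        (fun q : H →L[ℂ] H => l.compContinuousAlternatingMap (Omega c q)) Set.univ := by
      refine contDiffOn_alternating_of_apply fun v w => ?_
      have h2 := (tr.restrictScalars ℝ).contDiff.comp_contDiffOn
        ((contDiffOn_id (𝕜 := ℝ) (n := ∞) (s := Set.univ)).mul
          (contDiffOn_const (c := v * w - w * v)))
      exact l.contDiff.comp_contDiffOn (contDiffOn_const.mul (contDiffOn_const.mul h2))
    exact ((contDiffOn_univ.1 h1).contDiffAt).differentiableAt (by simp)
  refine ⟨hd, ?_⟩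
  rw [extDeriv_apply hd]
  refine Finset.sum_eq_zero fun i _ => ?_
  set w := i.removeNth v with hw
  have hwo (j) : q * w j + w j * q = w j := hv _
  let L : (H →L[ℂ] H) →L[ℝ] W := l ∘L (((Complex.I * c) • tr.restrictScalars ℝ) ∘L
    (ContinuousLinearMap.mul ℝ (H →L[ℂ] H)).flip (w 0 * w 1 - w 1 * w 0))
  have hL : (fun q : H →L[ℂ] H => l.compContinuousAlternatingMap (Omega c q) w) = L := by
    funext p
    change l (Complex.I * (c * tr (p * (w 0 * w 1 - w 1 * w 0)))) =
      l ((Complex.I * c) * tr (p * (w 0 * w 1 - w 1 * w 0)))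
    rw [mul_assoc]
  have h0 : L (v i) = 0 := by
    change l ((Complex.I * c) * tr (v i * (w 0 * w 1 - w 1 * w 0))) = 0
    rw [mul_sub, map_sub, ← mul_assoc, ← mul_assoc, tr_mul_mul_offDiag hq (hv i) (hwo 0) (hwo 1),
      tr_mul_mul_offDiag hq (hv i) (hwo 1) (hwo 0)]
    simp
  rw [hL, L.fderiv, h0, smul_zero]

theorem extDeriv_pullback_Omega {F W : Type*} [NormedAddCommGroup F] [NormedSpace ℝ F]
    [NormedAddCommGroup W] [NormedSpace ℝ W] [FiniteDimensional ℝ W]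
    (c : ℝ) (l : ℂ →L[ℝ] W) {S : Set (H →L[ℂ] H)} (hS : ∀ q ∈ S, q * q = q) {U : Set F}
    {ψ : F → H →L[ℂ] H} (h : IsParam S U ψ) {u : F} (hu : u ∈ U) :
    extDeriv (pullback ψ fun q => l.compContinuousAlternatingMap (Omega c q)) u = 0 := by
  have hψ := hS _ (h.mapsTo hu)
  have hd := (extDeriv_Omega c l hψ 0 (by simp)).1
  unfold pullback
  rw [extDeriv_pullback hd (h.contDiffAt hu)
    (by rw [minSmoothness_of_isRCLikeNormedField]; exact WithTop.coe_le_coe.2 le_top)]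
  ext v
  exact (extDeriv_Omega c l hψ _ fun i => offDiag_of_mem_tangentSpace hS (h.fderiv_mem hu _)).2

/-- Since `Tr (q [A, B]) = -Tr ([A, q] B)`, non-degeneracy of the trace form gives non-degeneracy of
`Ω`, as `[·, q]` is invertible on off-diagonal operators. -/
theorem Omega_nondegenerate {c : ℝ} (hc : 0 < c) {q A : H →L[ℂ] H} (hq : q * q = q)
    (hA : q * A + A * q = A) (h : ∀ B, q * B + B * q = B → Omega c q ![A, B] = 0) : A = 0 := by
  obtain ⟨h1, h2⟩ := offDiag_commutator hq hA
  have h3 : A * q - q * A = 0 := by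
    refine eq_zero_of_tr_star_mul_self ?_
    set C := A * q - q * A with hC
    have hB : q * (q * star C * (1 - q) + (1 - q) * star C * q) +
        (q * star C * (1 - q) + (1 - q) * star C * q) * q =
        q * star C * (1 - q) + (1 - q) * star C * q := by
      refine offDiag_of_blocks ?_ ?_
      · have : q * (q * star C * (1 - q) + (1 - q) * star C * q) * q =
          q * q * star C * (q - q * q) + (q - q * q) * star C * q * q := by noncomm_ring
        rw [this, hq]; simp
      · have : (1 - q) * (q * star C * (1 - q) + (1 - q) * star C * q) * (1 - q) =
          (q - q * q) * star C * (1 - q) * (1 - q) +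
            (1 - q) * (1 - q) * star C * (q - q * q) := by noncomm_ring
        rw [this, hq]; simp
    have h4 := h _ hB
    have h5 : tr (q * (A * (q * star C * (1 - q) + (1 - q) * star C * q) -
        (q * star C * (1 - q) + (1 - q) * star C * q) * A)) = - tr (C * star C) := by
      rw [← tr_offDiag_mul hq h1]
      generalize q * star C * (1 - q) + (1 - q) * star C * q = B
      rw [mul_sub, map_sub, ← mul_assoc q B A, tr_mul_comm (q * B) A, hC, sub_mul, map_sub]
      rw [mul_assoc, mul_assoc]; ring
    rw [Omega_apply, h5] at h4
    have h6 : tr (C * star C) = 0 := by simpa [hc.ne'] using h4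
    rw [tr_mul_comm, h6]; rfl
  rw [← h2, h3]; simp

theorem isSymplectic_Omega (n : ℕ) {c : ℝ} (hc : 0 < c) :
    IsSymplectic (idempotents H n) (Omega c) where
  smooth _ _ _ h := contDiffOn_pullback_Omega c (.id ℝ ℂ) h.isOpen h.contDiffOn
  closed _ _ _ h _ hu := extDeriv_pullback_Omega c (.id ℝ ℂ) (fun _ hq => hq.1) h hu
  nondegenerate _ hq _ hA h := Omega_nondegenerate hc hq.1
    ((mem_tangentSpace_idempotents hq).1 hA) fun B hB =>
      h B ((mem_tangentSpace_idempotents hq).2 hB)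

theorem isKahler_grassmannian (n : ℕ) {c : ℝ} (hc : 0 < c) :
    IsKahler (grassmannian H n) complexJ (reOmega c) where
  almostComplex := isAlmostComplex_complexJ_grassmannian n
  integrable := isIntegrable_complexJ_grassmannian n
  symplectic :=
    { smooth _ _ _ h := contDiffOn_pullback_Omega c Complex.reCLM h.isOpen h.contDiffOn
      closed _ _ _ h _ hu := extDeriv_pullback_Omega c Complex.reCLM
        (fun _ hq => mul_self_of_mem_grassmannian hq) h hu
      nondegenerate p hp A hA h := by
        by_contra h0
        have hJ := (isAlmostComplex_complexJ_grassmannian n).mem p hp A hA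
        rw [mem_tangentSpace_grassmannian hp] at hA
        have h1 := reOmega_complexJ_pos hc (mul_self_of_mem_grassmannian hp)
          (mem_grassmannian_iff.1 hp).2 hA.1 hA.2 h0
        have h2 := h _ hJ
        rw [reOmega_apply] at h1 h2
        rw [← neg_sub, mul_neg, map_neg, Complex.neg_im] at h2
        linarith }
  invariant p hp A hA B hB := by
    rw [mem_tangentSpace_grassmannian hp] at hA hB
    exact congrArg Complex.re (Omega_complexJ (mul_self_of_mem_grassmannian hp) hA.1 hB.1)
  pos p hp A hA h0 := by
    rw [mem_tangentSpace_grassmannian hp] at hA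
    exact reOmega_complexJ_pos hc (mul_self_of_mem_grassmannian hp)
      (mem_grassmannian_iff.1 hp).2 hA.1 hA.2 h0

end Manifolds

/-! ### Holomorphy of the symplectic form -/

section Holomorphic

theorem complex_smul_eq {X : Type*} [AddCommGroup X] [Module ℝ X] [Module ℂ X]
    [IsScalarTower ℝ ℂ X] (z : ℂ) (x : X) : z • x = z.re • x + z.im • (Complex.I • x) := by
  conv_lhs => rw [← Complex.re_add_im z, add_smul, mul_smul]
  rw [← algebraMap_smul ℂ z.re x, ← algebraMap_smul ℂ z.im (Complex.I • x)]
  rfl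

theorem fderiv_apply_const {F G : Type*} [NormedAddCommGroup F] [NormedSpace ℝ F]
    [NormedAddCommGroup G] [NormedSpace ℝ G] {f : F → F →L[ℝ] G} {u : F}
    (hf : DifferentiableAt ℝ f u) (x w : F) :
    fderiv ℝ (fun y => f y x) u w = fderiv ℝ f u w x := by
  rw [(hf.hasFDerivAt.clm_apply (hasFDerivAt_const x u)).fderiv]
  simp

/-- The Cauchy–Riemann equations in several variables. -/
theorem differentiableAt_complex_of_fderiv {V G : Type*} [NormedAddCommGroup V] [NormedSpace ℝ V]
    [NormedSpace ℂ V] [IsScalarTower ℝ ℂ V] [NormedAddCommGroup G] [NormedSpace ℝ G]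
    [NormedSpace ℂ G] [IsScalarTower ℝ ℂ G] {g : V → G} {u : V} (hg : DifferentiableAt ℝ g u)
    (h : ∀ w, fderiv ℝ g u (Complex.I • w) = Complex.I • fderiv ℝ g u w) :
    DifferentiableAt ℂ g u := by
  rw [differentiableAt_iff_restrictScalars ℝ hg]
  refine ⟨⟨⟨(fderiv ℝ g u).toLinearMap.toAddHom, fun z w => ?_⟩, (fderiv ℝ g u).continuous⟩, rfl⟩
  change fderiv ℝ g u (z • w) = z • fderiv ℝ g u w
  rw [complex_smul_eq z w, complex_smul_eq z, map_add, map_smul, map_smul, h]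

variable {H : Type*} [NormedAddCommGroup H] [InnerProductSpace ℂ H]

theorem IsHolParam.differentiableOn {S : Set (H →L[ℂ] H)} {m : ℕ}
    {U : Set (EuclideanSpace ℂ (Fin m))} {ψ : EuclideanSpace ℂ (Fin m) → H →L[ℂ] H}
    (h : IsHolParam S complexI U ψ) : DifferentiableOn ℂ ψ U := fun u hu =>
  (differentiableAt_complex_of_fderiv (h.1.differentiableAt hu)
    fun w => h.2 u hu w).differentiableWithinAt

/-- The partial derivatives of a holomorphic parametrization are holomorphic. The Cauchy–Riemann
equations for them follow from those for `ψ` by the symmetry of the second derivative. -/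
theorem IsHolParam.differentiableOn_fderiv {S : Set (H →L[ℂ] H)} {m : ℕ}
    {U : Set (EuclideanSpace ℂ (Fin m))} {ψ : EuclideanSpace ℂ (Fin m) → H →L[ℂ] H}
    (h : IsHolParam S complexI U ψ) (v : EuclideanSpace ℂ (Fin m)) :
    DifferentiableOn ℂ (fun u => fderiv ℝ ψ u v) U := by
  intro u hu
  have hd : DifferentiableAt ℝ (fderiv ℝ ψ) u :=
    (h.1.contDiffOn_fderiv.contDiffAt (h.1.isOpen.mem_nhds hu)).differentiableAt (by simp)
  have hsymm : IsSymmSndFDerivAt ℝ ψ u := (h.1.contDiffAt hu).isSymmSndFDerivAt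
    (by rw [minSmoothness_of_isRCLikeNormedField]; exact WithTop.coe_le_coe.2 le_top)
  refine (differentiableAt_complex_of_fderiv ?_ fun w => ?_).differentiableWithinAt
  · exact hd.clm_apply (differentiableAt_const v)
  · rw [fderiv_apply_const hd, fderiv_apply_const hd, hsymm.eq, hsymm.eq w,
      ← fderiv_apply_const hd, ← fderiv_apply_const hd]
    have he : (fun u => fderiv ℝ ψ u (Complex.I • w)) =ᶠ[𝓝 u]
        fun u => complexI (0 : H →L[ℂ] H) (fderiv ℝ ψ u w) := by
      filter_upwards [h.1.isOpen.mem_nhds hu] with y hy using h.2 y hy w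
    have hc := (complexI (0 : H →L[ℂ] H)).hasFDerivAt.comp u
      (hd.clm_apply (differentiableAt_const w)).hasFDerivAt
    rw [he.fderiv_eq]
    exact congrArg (fun L => L v) hc.fderiv

theorem isHolomorphicForm_Omega [FiniteDimensional ℂ H] (n : ℕ) (c : ℝ) :
    IsHolomorphicForm (idempotents H n) complexI (Omega c) where
  type_two_zero q _ A _ B _ := by
    rw [Omega_apply, Omega_apply, complexI_apply, smul_mul_assoc, mul_smul_comm, ← smul_sub,
      mul_smul_comm, map_smul, smul_eq_mul]
    ring
  holomorphic m U ψ h v w := by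
    have h1 := h.differentiableOn.mul
      (((h.differentiableOn_fderiv v).mul (h.differentiableOn_fderiv w)).sub
        ((h.differentiableOn_fderiv w).mul (h.differentiableOn_fderiv v)))
    have h2 := tr.differentiable.comp_differentiableOn h1
    exact (h2.const_mul (c : ℂ)).const_mul Complex.I

end Holomorphic

/-! ### Lagrangian submanifolds -/

section Lagrangian

theorem mem_lowerBlock_one_sub {H : Type*} [NormedAddCommGroup H] [InnerProductSpace ℂ H]
    {p b : H →L[ℂ] H} :
    b ∈ lowerBlock (1 - p) ↔ p * b = b ∧ b * p = 0 := by
  rw [mem_lowerBlock, mul_sub, sub_mul, mul_one, one_mul, sub_eq_self, sub_eq_zero, and_comm,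
    eq_comm]

variable {H : Type*} [NormedAddCommGroup H] [InnerProductSpace ℂ H] [FiniteDimensional ℂ H]
  [CompleteSpace H]

/-- The fibre of `proj` over `p` is an affine space. -/
theorem mem_fibre_iff {n : ℕ} {p : H →L[ℂ] H} (hp : p ∈ grassmannian H n) {x : H →L[ℂ] H}
    (hx : x ∈ {q ∈ idempotents H n | proj q = p}) (y : H →L[ℂ] H) :
    y ∈ {q ∈ idempotents H n | proj q = p} ↔ y - x ∈ (lowerBlock (1 - p)).restrictScalars ℝ := by
  obtain ⟨hpi, hps⟩ := mem_grassmannian_iff.1 hp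
  obtain ⟨hx1, hx2⟩ := (proj_eq_iff hx.1.1 hps).1 hx.2
  rw [Submodule.restrictScalars_mem, mem_lowerBlock_one_sub, mul_sub, sub_mul, hx1, hx2,
    sub_left_inj, sub_eq_zero]
  constructor
  · rintro ⟨h1, h2⟩
    exact (proj_eq_iff h1.1 hps).1 h2
  · rintro ⟨h1, h2⟩
    have hy : y * y = y := by
      have : y * y = y * p * y := by rw [mul_assoc, h1]
      rw [this, h2, h1]
    refine ⟨⟨hy, ?_⟩, (proj_eq_iff hy hps).2 ⟨h1, h2⟩⟩
    rw [← tr_apply, ← h1, tr_mul_comm, h2]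
    exact hpi.2

theorem isLagrangian_fibre {n : ℕ} {c : ℝ} (hc : 0 < c) {p : H →L[ℂ] H}
    (hp : p ∈ grassmannian H n) :
    IsLagrangian (idempotents H n) (Omega c) {q ∈ idempotents H n | proj q = p} := by
  have := finiteDimensional_real (H := H)
  have hps := (mem_grassmannian_iff.1 hp).2
  refine ⟨fun q hq => hq.1, ⟨_, isSubmanifold_affine fun x hx => mem_fibre_iff hp hx⟩, ?_⟩
  intro x hx A hA
  rw [mem_tangentSpace_idempotents hx.1] at hA
  rw [tangentSpace_affine (mem_fibre_iff hp hx)]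
  obtain ⟨hx1, hx2⟩ := (proj_eq_iff hx.1.1 hps).1 hx.2
  have hxx := hx.1.1
  have hA0 := offDiag_mul_eq_zero hxx hA
  -- the tangent space of the fibre consists of the operators from `ker x` to the image of `x`
  have hK (b : H →L[ℂ] H) : b ∈ (lowerBlock (1 - p)).restrictScalars ℝ ↔ x * b = b ∧ b * x = 0 := by
    rw [Submodule.restrictScalars_mem, mem_lowerBlock_one_sub]
    constructor
    · rintro ⟨h1, h2⟩
      exact ⟨by rw [← h1, ← mul_assoc, hx2], by rw [← hx1, ← mul_assoc, h2, zero_mul]⟩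
    · rintro ⟨h1, h2⟩
      exact ⟨by rw [← h1, ← mul_assoc, hx1], by rw [← hx2, ← mul_assoc, h2, zero_mul]⟩
  have hΩ (b : H →L[ℂ] H) (h1 : x * b = b) (h2 : b * x = 0) :
      Omega c x ![A, b] = -(Complex.I * (c * tr (A * b))) := by
    have h3 : tr (x * (A * b)) = 0 := by
      rw [tr_mul_comm, mul_assoc, h2, mul_zero, map_zero]
    rw [Omega_apply, mul_sub, map_sub, h3, ← mul_assoc x b A, h1, tr_mul_comm b A]
    ring
  rw [hK]
  constructor
  · rintro ⟨h1, h2⟩ b hb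
    obtain ⟨h3, h4⟩ := (hK b).1 hb
    have : A * b = 0 := by rw [← h3, ← mul_assoc, h2, zero_mul]
    rw [hΩ b h3 h4, this]; simp
  · intro h
    have hAx : A * x = 0 := by
      refine eq_zero_of_tr_star_mul_self ?_
      have hxA : x * (A * x) = 0 := by rw [← mul_assoc, hA0]
      have h1 : x * (x * star (A * x) * (1 - x)) = x * star (A * x) * (1 - x) := by
        rw [← mul_assoc, ← mul_assoc, hxx]
      have h2 : x * star (A * x) * (1 - x) * x = 0 := by
        rw [mul_assoc, sub_mul, hxx, one_mul, sub_self, mul_zero]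
      have h3 := h _ ((hK _).2 ⟨h1, h2⟩)
      rw [hΩ _ h1 h2] at h3
      have h4 : tr (A * (x * star (A * x) * (1 - x))) = tr (star (A * x) * (A * x)) := by
        generalize star (A * x) = C
        have h5 : (1 - x) * (A * x * C) = A * x * C := by
          rw [sub_mul, one_mul, ← mul_assoc x, hxA, zero_mul, sub_zero]
        rw [tr_mul_comm C, ← h5, tr_mul_comm (1 - x)]
        simp only [mul_assoc]
      rw [h4] at h3
      have h5 : tr (star (A * x) * (A * x)) = 0 := by simpa [hc.ne'] using h3
      rw [h5]; rfl
    rw [hAx, add_zero] at hA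
    exact ⟨hA, hAx⟩

theorem isLagrangian_grassmannian (n : ℕ) {c : ℝ} (hc : 0 < c) :
    IsLagrangian (idempotents H n) (imOmega c) (grassmannian H n) := by
  refine ⟨grassmannian_subset n, ⟨_, isSubmanifold_grassmannian n⟩, fun p hp A hA => ?_⟩
  obtain ⟨hpi, hps⟩ := mem_grassmannian_iff.1 hp
  rw [mem_tangentSpace_idempotents hpi] at hA
  rw [mem_tangentSpace_grassmannian hp]
  -- for self-adjoint operators, the trace of `p [A, B]` is imaginary
  have him (A B : H →L[ℂ] H) (hA : star A = A) (hB : star B = B) :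
      (tr (p * (A * B - B * A))).re = 0 := by
    have h1 : tr (p * (B * A)) = starRingEnd ℂ (tr (p * (A * B))) := by
      rw [← tr_star, star_mul, star_mul, hA, hB, hps, tr_mul_comm]
    rw [mul_sub, map_sub, h1]; simp
  constructor
  · rintro ⟨-, hAs⟩ B hB
    rw [mem_tangentSpace_grassmannian hp] at hB
    rw [imOmega_apply, him A B hAs hB.2, mul_zero]
  · intro h
    refine ⟨hA, ?_⟩
    have hAs : p * star A + star A * p = star A := by
      have := congrArg star hA
      simp only [star_add, star_mul, hps] at this
      rw [add_comm]; exact this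
    -- twice the imaginary part of `A`
    set D := Complex.I • (star A - A) with hD
    have hDs : star D = D := by
      rw [hD, star_smul, star_sub, star_star]
      simp only [RCLike.star_def, Complex.conj_I, neg_smul]
      rw [← smul_neg, neg_sub]
    have hDo : p * D + D * p = D := by
      rw [hD, mul_smul_comm, smul_mul_assoc, ← smul_add, mul_sub, sub_mul, sub_add_sub_comm, hAs,
        hA]
    have hJ : complexJ p D ∈ tangentSpace (grassmannian H n) p :=
      (isAlmostComplex_complexJ_grassmannian n).mem p hp D
        ((mem_tangentSpace_grassmannian hp).2 ⟨hDo, hDs⟩)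
    have hJs := ((mem_tangentSpace_grassmannian hp).1 hJ).2
    have hAD : A = (2⁻¹ : ℂ) • (star A + A) + (Complex.I * 2⁻¹) • D := by
      rw [hD, smul_smul, mul_assoc, mul_comm (2⁻¹ : ℂ), ← mul_assoc, Complex.I_mul_I]
      module
    have hS : star ((2⁻¹ : ℂ) • (star A + A)) = (2⁻¹ : ℂ) • (star A + A) := by
      rw [star_smul, star_add, star_star, add_comm]; simp
    have h1 := h _ hJ
    rw [imOmega_apply, hAD, add_mul, mul_add, add_sub_add_comm, mul_add, map_add, Complex.add_re,
      him _ _ hS hJs, zero_add, smul_mul_assoc, mul_smul_comm, ← smul_sub, mul_smul_comm, map_smul,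
      ← neg_sub (complexJ p D * D), mul_neg, map_neg, tr_commutator_complexJ hpi.1 hDo,
      smul_eq_mul, neg_neg] at h1
    have h2 : (Complex.I * 2⁻¹ * (2 * Complex.I * tr (p * D * D))).re = -(tr (p * D * D)).re := by
      have : Complex.I * 2⁻¹ * (2 * Complex.I * tr (p * D * D)) =
          Complex.I * Complex.I * tr (p * D * D) := by ring
      rw [this, Complex.I_mul_I]; simp
    rw [h2] at h1
    have hD0 : D = 0 := by
      by_contra h0
      have := tr_sq_pos hpi.1 hps hDo hDs h0
      have := mul_pos hc this
      linarith
    rw [hD, smul_eq_zero, sub_eq_zero] at hD0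
    exact hD0.resolve_left Complex.I_ne_zero

end Lagrangian

/-! ### Smoothness of the orthogonal projection onto the image -/

section Proj

variable {H : Type*} [NormedAddCommGroup H] [InnerProductSpace ℂ H] [FiniteDimensional ℂ H]
  [CompleteSpace H]

theorem proj_mul_add_star_sub_one {q : H →L[ℂ] H} (hq : q * q = q) :
    proj q * (q + star q - 1) = q := by
  have h1 : proj q * star q = proj q := by
    rw [← star_proj q, ← star_mul, self_mul_proj hq]
  rw [mul_sub, mul_add, proj_mul_self, h1, mul_one, add_sub_cancel_right]

theorem isUnit_add_star_sub_one {q : H →L[ℂ] H} (hq : q * q = q) :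
    IsUnit (q + star q - 1) := by
  have hinj : Function.Injective ((q + star q - 1 : H →L[ℂ] H) : H →ₗ[ℂ] H) := by
    rw [← LinearMap.ker_eq_bot, LinearMap.ker_eq_bot']
    intro x hx
    have hx' : (q + star q - 1) x = 0 := hx
    have h1 : q x = 0 := by
      conv_lhs => rw [← proj_mul_add_star_sub_one hq]
      rw [mul_apply_eq_comp, hx', map_zero]
    have h2 : star q x = x := by
      have : q x + star q x - x = 0 := hx'
      rwa [h1, zero_add, sub_eq_zero] at this
    have h3 : inner ℂ (star q x) x = 0 := by
      rw [ContinuousLinearMap.star_eq_adjoint, ContinuousLinearMap.adjoint_inner_left, h1,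
        inner_zero_right]
    rwa [h2, inner_self_eq_zero] at h3
  exact ContinuousLinearMap.isUnit_iff_bijective.2
    ⟨hinj, LinearMap.injective_iff_surjective.1 hinj⟩

/-- A formula for the orthogonal projection onto the image of an idempotent, which is smooth
on a neighbourhood of the set of idempotents. -/
theorem proj_eq {q : H →L[ℂ] H} (hq : q * q = q) :
    proj q = q * Ring.inverse (q + star q - 1) := by
  calc proj q = proj q * ((q + star q - 1) * Ring.inverse (q + star q - 1)) := by
        rw [Ring.mul_inverse_cancel _ (isUnit_add_star_sub_one hq), mul_one]
    _ = q * Ring.inverse (q + star q - 1) := by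
        rw [← mul_assoc, proj_mul_add_star_sub_one hq]

theorem contDiffAt_mul_inverse {q : H →L[ℂ] H} (hq : q * q = q) :
    ContDiffAt ℝ ∞ (fun q : H →L[ℂ] H => q * Ring.inverse (q + star q - 1)) q := by
  have hs : ContDiff ℝ ∞ (fun q : H →L[ℂ] H => star q) :=
    (starL' ℝ : (H →L[ℂ] H) ≃L[ℝ] (H →L[ℂ] H)).contDiff
  exact contDiffAt_id.mul (contDiffAt_inverse_comp
    ((contDiff_id.add hs).sub contDiff_const).contDiffAt (isUnit_add_star_sub_one hq))

theorem continuousOn_proj (n : ℕ) : ContinuousOn (proj (H := H)) (idempotents H n) := by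
  intro q hq
  exact (contDiffAt_mul_inverse hq.1).continuousAt.continuousWithinAt.congr
    (fun y hy => proj_eq hy.1) (proj_eq hq.1)

/-! ### Idempotents as covectors -/

/-- The idempotent `p + p B` lies in the fibre of `proj` over `p`. -/
theorem add_mul_mem_fibre {n : ℕ} {p B : H →L[ℂ] H} (hp : p ∈ grassmannian H n)
    (hB : p * B + B * p = B) : p + p * B ∈ idempotents H n ∧ proj (p + p * B) = p := by
  have hpp := mul_self_of_mem_grassmannian hp
  refine (mem_fibre_iff hp (x := p) ⟨grassmannian_subset n hp, proj_eq_self hp⟩ _).2 ?_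
  rw [Submodule.restrictScalars_mem, mem_lowerBlock_one_sub, add_sub_cancel_left, ← mul_assoc, hpp]
  exact ⟨rfl, offDiag_mul_eq_zero hpp hB⟩

/-- Every idempotent has the form `p + p B`, where `p` is the orthogonal projection onto the image
and `B` is tangent to the Grassmannian at `p`. -/
theorem exists_eq_add_mul {n : ℕ} {q : H →L[ℂ] H} (hq : q ∈ idempotents H n) :
    ∃ B, proj q * B + B * proj q = B ∧ star B = B ∧ q = proj q + proj q * B := by
  have hp := proj_mem hq
  set p := proj q with hpq
  have hps : star p = p := star_proj q
  have h := (mem_fibre_iff hp (x := p) ⟨grassmannian_subset n hp, proj_eq_self hp⟩ q).1 ⟨hq, rfl⟩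
  rw [Submodule.restrictScalars_mem, mem_lowerBlock_one_sub] at h
  set b := q - p with hb
  have h1 := congrArg star h.1
  have h2 := congrArg star h.2
  rw [star_mul, hps] at h1 h2
  rw [star_zero] at h2
  refine ⟨b + star b, ?_, ?_, ?_⟩
  · simp only [mul_add, add_mul, h.1, h.2, h1, h2]; abel
  · rw [star_add, star_star, add_comm]
  · rw [mul_add, h.1, h2, hb]; abel

/-- The trace pairing of a fibre of `proj` with the tangent space of the Grassmannian is
non-degenerate, so an idempotent is determined by its covector. -/
theorem eq_of_covector_eq {n : ℕ} {q r : H →L[ℂ] H} (hq : q ∈ idempotents H n)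
    (hr : r ∈ idempotents H n) (hqr : proj q = proj r)
    (h : ∀ A ∈ tangentSpace (grassmannian H n) (proj q), (tr (q * A)).re = (tr (r * A)).re) :
    q = r := by
  have hp := proj_mem hq
  obtain ⟨B, hB, hBs, hqB⟩ := exists_eq_add_mul hq
  obtain ⟨C, hC, hCs, hrC⟩ := exists_eq_add_mul hr
  rw [← hqr] at hC hrC
  have hD : proj q * (B - C) + (B - C) * proj q = B - C := by
    rw [mul_sub, sub_mul, sub_add_sub_comm, hB, hC]
  have hDs : star (B - C) = B - C := by rw [star_sub, hBs, hCs]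
  have h1 := h (B - C) ((mem_tangentSpace_grassmannian hp).2 ⟨hD, hDs⟩)
  have h2 : (tr (proj q * (B - C) * (B - C))).re = 0 := by
    have : proj q * (B - C) = q - r := by
      conv_rhs => rw [hqB, hrC]
      rw [mul_sub]; abel
    rw [this, sub_mul, map_sub, Complex.sub_re, h1, sub_self]
  have h3 : B - C = 0 := by
    by_contra h0
    exact (tr_sq_pos (mul_self_of_mem_grassmannian hp) (star_proj q) hD hDs h0).ne' h2
  rw [hqB, hrC, sub_eq_zero.1 h3]

theorem covector_eq_zero_iff {n : ℕ} (q : idempotents H n) :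
    (toCotangent n q).2 = 0 ↔ (q : H →L[ℂ] H) ∈ grassmannian H n := by
  have hp := proj_mem q.2
  have hpp := mul_self_of_mem_grassmannian hp
  have h0 (A) (hA : A ∈ tangentSpace (grassmannian H n) (proj (q : H →L[ℂ] H))) :
      (tr (proj (q : H →L[ℂ] H) * A)).re = 0 := by
    rw [tr_mul_offDiag hpp ((mem_tangentSpace_grassmannian hp).1 hA).1, Complex.zero_re]
  constructor
  · intro h
    have : (q : H →L[ℂ] H) = proj (q : H →L[ℂ] H) := by
      refine eq_of_covector_eq q.2 (grassmannian_subset n hp) (proj_eq_self hp).symm fun A hA => ?_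
      rw [h0 A hA]
      exact congrArg (fun ξ => ξ ⟨A, hA⟩) h
    rw [this]; exact hp
  · intro hq
    ext ⟨A, hA⟩
    have h := h0 A hA
    rw [proj_eq_self hq] at h
    exact h

/-! ### The diffeomorphism onto the cotangent bundle -/

/-- The pairing `(X, Y) ↦ Re tr (p X Y)`. On the tangent space of the Grassmannian at `p` it is an
inner product, half of the Hilbert–Schmidt one. -/
def tracePairing (p : H →L[ℂ] H) : (H →L[ℂ] H) →L[ℝ] (H →L[ℂ] H) →L[ℝ] ℝ :=
  ContinuousLinearMap.compL ℝ (H →L[ℂ] H) (H →L[ℂ] H) ℝ (Complex.reCLM ∘L tr.restrictScalars ℝ) ∘L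
    ContinuousLinearMap.mul ℝ (H →L[ℂ] H) ∘L ContinuousLinearMap.mul ℝ (H →L[ℂ] H) p

variable {F : Type*} [NormedAddCommGroup F] [NormedSpace ℝ F]

/-- The Gram form of the parametrization `ψ` at `u`, for the pairing `tracePairing (ψ u)`. -/
def gram (ψ : F → H →L[ℂ] H) (u : F) : F →L[ℝ] F →L[ℝ] ℝ :=
  (tracePairing (ψ u)).bilinearComp (fderiv ℝ ψ u) (fderiv ℝ ψ u)

theorem gram_apply (ψ : F → H →L[ℂ] H) (u v w : F) :
    gram ψ u v w = (tr (ψ u * fderiv ℝ ψ u v * fderiv ℝ ψ u w)).re := rfl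

/-- The parametrization of the cotangent bundle, viewed as a set of idempotents, that is induced by
a parametrization of the Grassmannian. -/
def cotangentParam (ψ : F → H →L[ℂ] H) (x : F × (F →L[ℝ] ℝ)) : H →L[ℂ] H :=
  ψ x.1 + ψ x.1 * fderiv ℝ ψ x.1 ((gram ψ x.1).inverse x.2)

variable {n : ℕ} {U : Set F} {ψ : F → H →L[ℂ] H}

theorem fderiv_offDiag (h : IsParam (grassmannian H n) U ψ) {u : F} (hu : u ∈ U) (v : F) :
    ψ u * fderiv ℝ ψ u v + fderiv ℝ ψ u v * ψ u = fderiv ℝ ψ u v ∧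
      star (fderiv ℝ ψ u v) = fderiv ℝ ψ u v :=
  (mem_tangentSpace_grassmannian (h.mapsTo hu)).1 (h.fderiv_mem hu v)

theorem cotangentParam_mem (h : IsParam (grassmannian H n) U ψ) {u : F} (hu : u ∈ U)
    (η : F →L[ℝ] ℝ) : cotangentParam ψ (u, η) ∈ idempotents H n ∧
      proj (cotangentParam ψ (u, η)) = ψ u :=
  add_mul_mem_fibre (h.mapsTo hu) (fderiv_offDiag h hu _).1

variable [FiniteDimensional ℝ F]

theorem exists_equiv_gram (h : IsParam (grassmannian H n) U ψ) {u : F} (hu : u ∈ U) :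
    ∃ e : F ≃L[ℝ] (F →L[ℝ] ℝ), (e : F →L[ℝ] (F →L[ℝ] ℝ)) = gram ψ u := by
  have hinj : Function.Injective (gram ψ u : F →ₗ[ℝ] (F →L[ℝ] ℝ)) := by
    rw [← LinearMap.ker_eq_bot, LinearMap.ker_eq_bot']
    intro v hv
    have h1 : gram ψ u v v = 0 := congrArg (fun l : F →L[ℝ] ℝ => l v) hv
    rw [gram_apply] at h1
    have h2 : fderiv ℝ ψ u v = 0 := by
      by_contra h0
      obtain ⟨hpi, hps⟩ := mem_grassmannian_iff.1 (h.mapsTo hu)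
      obtain ⟨h3, h4⟩ := fderiv_offDiag h hu v
      exact (tr_sq_pos hpi.1 hps h3 h4 h0).ne' h1
    exact h.injective_fderiv u hu (by rw [h2, map_zero])
  have hfr : Module.finrank ℝ F = Module.finrank ℝ (F →L[ℝ] ℝ) := by
    rw [← (LinearMap.toContinuousLinearMap : (F →ₗ[ℝ] ℝ) ≃ₗ[ℝ] (F →L[ℝ] ℝ)).finrank_eq,
      Module.finrank_linearMap, Module.finrank_self, mul_one]
  refine ⟨(LinearEquiv.ofInjectiveOfFinrankEq _ hinj hfr).toContinuousLinearEquiv, ?_⟩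
  ext v w
  rfl

theorem gram_inverse_apply (h : IsParam (grassmannian H n) U ψ) {u : F} (hu : u ∈ U)
    (η : F →L[ℝ] ℝ) : gram ψ u ((gram ψ u).inverse η) = η := by
  obtain ⟨e, he⟩ := exists_equiv_gram h hu
  rw [← he, ContinuousLinearMap.inverse_equiv]
  exact e.apply_symm_apply η

theorem contDiffOn_gram (h : IsParam (grassmannian H n) U ψ) : ContDiffOn ℝ ∞ (gram ψ) U := by
  refine contDiffOn_clm_apply.2 fun v => contDiffOn_clm_apply.2 fun w => ?_
  have h1 := (h.contDiffOn.mul (h.contDiffOn_fderiv_apply v)).mul (h.contDiffOn_fderiv_apply w)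
  exact Complex.reCLM.contDiff.comp_contDiffOn
    ((tr.restrictScalars ℝ).contDiff.comp_contDiffOn h1)

theorem contDiffAt_cotangentParam (h : IsParam (grassmannian H n) U ψ) {u : F} (hu : u ∈ U)
    (η : F →L[ℝ] ℝ) : ContDiffAt ℝ ∞ (cotangentParam ψ) (u, η) := by
  have := FiniteDimensional.complete ℝ F
  have hU := h.isOpen.mem_nhds hu
  have h1 : ContDiffAt ℝ ∞ (fun x : F × (F →L[ℝ] ℝ) => ψ x.1) (u, η) :=
    (h.contDiffAt hu).comp (u, η) contDiffAt_fst
  have h2 : ContDiffAt ℝ ∞ (fun x : F × (F →L[ℝ] ℝ) => fderiv ℝ ψ x.1) (u, η) :=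
    (h.contDiffOn_fderiv.contDiffAt hU).comp (u, η) contDiffAt_fst
  have h3 : ContDiffAt ℝ ∞ (fun x : F × (F →L[ℝ] ℝ) => gram ψ x.1) (u, η) :=
    ContDiffAt.comp (g := gram ψ) (f := Prod.fst) (u, η)
      ((contDiffOn_gram h).contDiffAt hU) contDiffAt_fst
  have h4 : ContDiffAt ℝ ∞ (fun x : F × (F →L[ℝ] ℝ) => (gram ψ x.1).inverse) (u, η) := by
    obtain ⟨e, he⟩ := exists_equiv_gram h hu
    have h5 : ContDiffAt ℝ ∞ ContinuousLinearMap.inverse (gram ψ u) := by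
      rw [← he]; exact contDiffAt_map_inverse e
    exact ContDiffAt.comp (u, η) h5 h3
  exact h1.add (h1.mul (h2.clm_apply (h4.clm_apply contDiffAt_snd)))

theorem tr_cotangentParam_mul (h : IsParam (grassmannian H n) U ψ) {u : F} (hu : u ∈ U)
    (η : F →L[ℝ] ℝ) (v : F) : (tr (cotangentParam ψ (u, η) * fderiv ℝ ψ u v)).re = η v := by
  have h1 := tr_mul_offDiag (mul_self_of_mem_grassmannian (h.mapsTo hu)) (fderiv_offDiag h hu v).1
  have h2 : gram ψ u ((gram ψ u).inverse η) v = η v := by rw [gram_inverse_apply h hu]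
  rw [gram_apply] at h2
  rw [cotangentParam, add_mul, map_add, h1, zero_add]
  exact h2

/-- The differential of the parametrization is injective: the base point and the
covector are both recovered from the idempotent, by a smooth map and by a linear map. -/
theorem injective_fderiv_cotangentParam (h : IsParam (grassmannian H n) U ψ) {u : F} (hu : u ∈ U)
    (η : F →L[ℝ] ℝ) : Function.Injective (fderiv ℝ (cotangentParam ψ) (u, η)) := by
  have hd : HasFDerivAt (cotangentParam ψ) (fderiv ℝ (cotangentParam ψ) (u, η)) (u, η) :=
    ((contDiffAt_cotangentParam h hu η).differentiableAt (by simp)).hasFDerivAt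
  change Function.Injective
    (fderiv ℝ (cotangentParam ψ) (u, η) : F × (F →L[ℝ] ℝ) →ₗ[ℝ] (H →L[ℂ] H))
  rw [← LinearMap.ker_eq_bot, LinearMap.ker_eq_bot']
  rintro ⟨v, ζ⟩ hv
  have hv' : fderiv ℝ (cotangentParam ψ) (u, η) (v, ζ) = 0 := hv
  have hline : HasDerivAt (fun t : ℝ => (u, η) + t • (v, ζ)) (v, ζ) 0 := by
    simpa using ((hasDerivAt_id (0 : ℝ)).smul_const (v, ζ)).const_add (u, η)
  have hd0 : HasFDerivAt (cotangentParam ψ) (fderiv ℝ (cotangentParam ψ) (u, η))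
      ((u, η) + (0 : ℝ) • (v, ζ)) := by simpa using hd
  have hγ : HasDerivAt (fun t : ℝ => cotangentParam ψ ((u, η) + t • (v, ζ))) 0 0 := by
    rw [← hv']; exact hd0.comp_hasDerivAt (0 : ℝ) hline
  have hline1 : HasDerivAt (fun t : ℝ => u + t • v) v 0 := by
    simpa using ((hasDerivAt_id (0 : ℝ)).smul_const v).const_add u
  have hnear : ∀ᶠ t in 𝓝 (0 : ℝ), u + t • v ∈ U :=
    hline1.continuousAt.preimage_mem_nhds (by simpa using h.isOpen.mem_nhds hu)
  have hv0 : v = 0 := by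
    have hP : HasFDerivAt (fun q : H →L[ℂ] H => q * Ring.inverse (q + star q - 1))
        (fderiv ℝ (fun q : H →L[ℂ] H => q * Ring.inverse (q + star q - 1))
          (cotangentParam ψ (u, η))) (cotangentParam ψ ((u, η) + (0 : ℝ) • (v, ζ))) := by
      have := ((contDiffAt_mul_inverse (cotangentParam_mem h hu η).1.1).differentiableAt
        (by simp)).hasFDerivAt
      simpa using this
    have h1 := hP.comp_hasDerivAt (0 : ℝ) hγ
    rw [map_zero] at h1
    have h2 : HasDerivAt (fun t : ℝ => ψ (u + t • v)) (fderiv ℝ ψ u v) 0 := by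
      have : HasFDerivAt ψ (fderiv ℝ ψ u) (u + (0 : ℝ) • v) := by
        simpa using (h.differentiableAt hu).hasFDerivAt
      exact this.comp_hasDerivAt (0 : ℝ) hline1
    have h3 : fderiv ℝ ψ u v = 0 := by
      refine h2.unique (h1.congr_of_eventuallyEq ?_)
      filter_upwards [hnear] with t ht
      obtain ⟨h4, h5⟩ := cotangentParam_mem h ht (η + t • ζ)
      rw [← h5, proj_eq h4.1]
      rfl
    exact h.injective_fderiv u hu (by rw [h3, map_zero])
  subst hv0
  have hζ0 : ζ = 0 := by
    ext w
    have h1 : HasDerivAt (fun t : ℝ => η w + t • ζ w) (ζ w) 0 := by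
      simpa using ((hasDerivAt_id (0 : ℝ)).smul_const (ζ w)).const_add (η w)
    have h2 := ((Complex.reCLM ∘L tr.restrictScalars ℝ).hasFDerivAt).comp_hasDerivAt (0 : ℝ)
      (hγ.mul_const (fderiv ℝ ψ u w))
    rw [zero_mul, map_zero] at h2
    refine h1.unique (h2.congr_of_eventuallyEq (Filter.Eventually.of_forall fun t => ?_))
    have h3 := tr_cotangentParam_mul h hu (η + t • ζ) w
    have h4 : (u, η) + t • ((0 : F), ζ) = (u, η + t • ζ) := by simp
    change η w + t • ζ w = (tr (cotangentParam ψ ((u, η) + t • ((0 : F), ζ)) * fderiv ℝ ψ u w)).re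
    rw [h4, h3]
    rfl
  rw [hζ0]; rfl

theorem eq_cotangentParam (h : IsParam (grassmannian H n) U ψ) {u : F} (hu : u ∈ U)
    {q : H →L[ℂ] H} (hq : q ∈ idempotents H n) (hqu : proj q = ψ u) {η : F →L[ℝ] ℝ}
    (hη : ∀ v, η v = (tr (q * fderiv ℝ ψ u v)).re) : cotangentParam ψ (u, η) = q := by
  have := finiteDimensional_real (H := H)
  obtain ⟨h1, h2⟩ := cotangentParam_mem h hu η
  refine eq_of_covector_eq h1 hq (h2.trans hqu.symm) fun A hA => ?_
  rw [h2, h.tangentSpace_eq hu] at hA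
  obtain ⟨v, rfl⟩ := hA
  exact (tr_cotangentParam_mul h hu η v).trans (hη v)

theorem isParam_cotangentParam (h : IsParam (grassmannian H n) U ψ) :
    IsParam (idempotents H n) (U ×ˢ Set.univ) (cotangentParam ψ) := by
  have hm : Set.MapsTo (cotangentParam ψ) (U ×ˢ Set.univ) (idempotents H n) :=
    fun x hx => (cotangentParam_mem h hx.1 x.2).1
  have hc : ContDiffOn ℝ ∞ (cotangentParam ψ) (U ×ˢ Set.univ) :=
    fun x hx => (contDiffAt_cotangentParam h hx.1 x.2).contDiffWithinAt
  refine ⟨h.isOpen.prod isOpen_univ, hc, fun x hx => injective_fderiv_cotangentParam h hx.1 x.2,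
    hm, ?_⟩
  obtain ⟨σ, hσo, hσc, hσ, hσψ⟩ := h.exists_continuousOn_inverse
  let P : idempotents H n → grassmannian H n := fun q => ⟨proj q, proj_mem q.2⟩
  have hP : Continuous P := ((continuousOn_proj n).domRestrict).subtype_mk _
  have hσP : ContinuousOn (σ ∘ P) (P ⁻¹' {y | (y : H →L[ℂ] H) ∈ ψ '' U}) :=
    hσc.comp hP.continuousOn fun _ hy => hy
  let φ : idempotents H n → F × (F →L[ℝ] ℝ) := fun q => (σ (P q),
    (Complex.reCLM ∘L tr.restrictScalars ℝ) ∘L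
      (ContinuousLinearMap.mul ℝ (H →L[ℂ] H) q ∘L fderiv ℝ ψ (σ (P q))))
  refine isOpenEmbedding_restrict_of_continuous_inverse hc.continuousOn hm
    (O := P ⁻¹' {y | (y : H →L[ℂ] H) ∈ ψ '' U}) (hσo.preimage hP) (φ := φ) ?_ ?_ ?_
  · refine hσP.prodMk (continuousOn_const.clm_comp (ContinuousOn.clm_comp ?_ ?_))
    · exact ((ContinuousLinearMap.mul ℝ (H →L[ℂ] H)).continuous.comp
        continuous_subtype_val).continuousOn
    · exact h.contDiffOn_fderiv.continuousOn.comp hσP fun y hy => (hσ _ hy).1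
  · rintro ⟨u, η⟩ ⟨hu, -⟩
    obtain ⟨h1, h2⟩ := cotangentParam_mem h hu η
    have h3 : P ⟨cotangentParam ψ (u, η), h1⟩ = ⟨ψ u, h.mapsTo hu⟩ := Subtype.ext h2
    refine ⟨by rw [Set.mem_preimage, h3]; exact ⟨u, hu, rfl⟩, ?_⟩
    have h4 : σ (P ⟨cotangentParam ψ (u, η), h1⟩) = u := by rw [h3, hσψ u hu]
    refine Prod.ext h4 ?_
    ext v
    change (tr (cotangentParam ψ (u, η) *
      fderiv ℝ ψ (σ (P ⟨cotangentParam ψ (u, η), h1⟩)) v)).re = η v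
    rw [h4, tr_cotangentParam_mul h hu]
  · intro q hq
    obtain ⟨h1, h2⟩ := hσ _ hq
    exact ⟨⟨h1, trivial⟩, eq_cotangentParam h h1 q.2 h2.symm fun v => rfl⟩

theorem isDiffeoOntoCotangent (n : ℕ) :
    IsDiffeoOntoCotangent (idempotents H n) (grassmannian H n) (toCotangent n) := by
  have := finiteDimensional_real (H := H)
  refine ⟨⟨fun q r hqr => ?_, fun θ => ?_⟩, fun d U ψ h =>
    ⟨cotangentParam ψ, isParam_cotangentParam h, fun u hu η => ?_⟩⟩
  · obtain ⟨h1, h2⟩ := cotangent_congr hqr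
    have h1' : proj (q : H →L[ℂ] H) = proj (r : H →L[ℂ] H) := h1
    refine Subtype.ext (eq_of_covector_eq q.2 r.2 h1 fun A hA => h2 A hA ?_)
    change A ∈ tangentSpace (grassmannian H n) (proj (r : H →L[ℂ] H))
    rwa [← h1']
  · obtain ⟨⟨p, hp⟩, ξ⟩ := θ
    obtain ⟨U, ψ, h, u, hu, rfl⟩ := isSubmanifold_grassmannian n p hp
    -- the covector `ξ` in the coordinates given by `ψ`
    let η : EuclideanSpace ℝ (Fin (2 * (n * (Module.finrank ℂ H - n)))) →L[ℝ] ℝ :=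
      LinearMap.toContinuousLinearMap
        (ξ ∘ₗ (fderiv ℝ ψ u).toLinearMap.codRestrict _ (h.fderiv_mem hu))
    obtain ⟨h1, h2⟩ := cotangentParam_mem h hu η
    refine ⟨⟨_, h1⟩, cotangent_ext h2 fun A hA hA' => ?_⟩
    have hA'' := hA'
    rw [h.tangentSpace_eq hu] at hA''
    obtain ⟨v, rfl⟩ := hA''
    exact tr_cotangentParam_mul h hu η v
  · obtain ⟨h1, h2⟩ := cotangentParam_mem h hu η
    refine ⟨h1, h2, fun v => ⟨?_, tr_cotangentParam_mul h hu η v⟩⟩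
    have h3 : ((toCotangent n ⟨_, h1⟩).1 : H →L[ℂ] H) = ψ u := h2
    rw [h3]
    exact h.fderiv_mem hu v

end Proj

end CotGr

end

theorem mainTheorem2 {H : Type*} [NormedAddCommGroup H] [InnerProductSpace ℂ H]
    [FiniteDimensional ℂ H] (n : ℕ) (c : ℝ) (hc : 0 < c) :
    -- the idempotents of trace `n` form a manifold, with the expected tangent spaces,
    IsSubmanifold (4 * (n * (Module.finrank ℂ H - n))) (idempotents H n) ∧
    (∀ q ∈ idempotents H n, ∀ A : H →L[ℂ] H,
      A ∈ tangentSpace (idempotents H n) q ↔ q * A + A * q = A) ∧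
    -- which is identified with the cotangent bundle of the Grassmannian,
    IsSubmanifold (2 * (n * (Module.finrank ℂ H - n))) (grassmannian H n) ∧
    IsDiffeoOntoCotangent (idempotents H n) (grassmannian H n) (toCotangent n) ∧
    -- the zero section being the set of orthogonal projections;
    (∀ q : idempotents H n, (toCotangent n q).2 = 0 ↔ (q : H →L[ℂ] H) ∈ grassmannian H n) ∧
    grassmannian H n ⊆ idempotents H n ∧
    -- `I` and `J` are integrable, commuting almost complex structures,
    IsAlmostComplex (idempotents H n) complexI ∧
    IsAlmostComplex (idempotents H n) complexJ ∧
    IsIntegrable (idempotents H n) complexI ∧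
    IsIntegrable (idempotents H n) complexJ ∧
    (∀ q ∈ idempotents H n, ∀ A ∈ tangentSpace (idempotents H n) q,
      complexI q (complexJ q A) = complexJ q (complexI q A)) ∧
    -- `Ω` is an `I`-holomorphic symplectic form, invariant under `J`,
    IsHolomorphicForm (idempotents H n) complexI (Omega c) ∧
    IsSymplectic (idempotents H n) (Omega c) ∧
    (∀ q ∈ idempotents H n, ∀ A ∈ tangentSpace (idempotents H n) q,
      ∀ B ∈ tangentSpace (idempotents H n) q,
        Omega c q ![complexJ q A, complexJ q B] = Omega c q ![A, B]) ∧
    -- the cotangent fibres are Lagrangian,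
    (∀ p ∈ grassmannian H n,
      IsLagrangian (idempotents H n) (Omega c) {q ∈ idempotents H n | proj q = p}) ∧
    -- and the zero section is Kähler for `Re Ω` and Lagrangian for `Im Ω`.
    IsKahler (grassmannian H n) complexJ (reOmega c) ∧
    IsLagrangian (idempotents H n) (imOmega c) (grassmannian H n) := by
  have : CompleteSpace H := FiniteDimensional.complete ℂ H
  exact ⟨isSubmanifold_idempotents n, fun q hq A => mem_tangentSpace_idempotents hq,
    isSubmanifold_grassmannian n, isDiffeoOntoCotangent n, covector_eq_zero_iff,
    grassmannian_subset n, isAlmostComplex_complexI n, isAlmostComplex_complexJ n,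
    isIntegrable_complexI n, isIntegrable_complexJ n, fun q _ A _ => complexI_complexJ q A,
    isHolomorphicForm_Omega n c, isSymplectic_Omega n hc,
    fun q hq A hA B hB => Omega_complexJ hq.1 ((mem_tangentSpace_idempotents hq).1 hA)
      ((mem_tangentSpace_idempotents hq).1 hB),
    fun p hp => isLagrangian_fibre hc hp, isKahler_grassmannian n hc,
    isLagrangian_grassmannian n hc⟩
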